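/- Let $n\ge 2$. For Schwartz functions $f,g$ on $\mathbb{R}^n$ and $\delta>0$, the bilinear Bochner–Riesz operator is $$S^\delta(f,g)(x)=\iint_{|\xi|^2+|\eta|^2\le 1}\bigl(1-|\xi|^2-|\eta|^2\bigr)^{\delta}\,\widehat f(\xi)\,\widehat g(\eta)\,e^{2\pi i x\cdot(\xi+\eta)}\,d\xi\,d\eta ,\qquad \widehat f(\xi)=\int_{\mathbb{R}^n}e^{-2\pi i x\cdot\xi}f(x)\,dx .$$ Let $p,q,r'\in[1,\infty)$ with $\frac1p+\frac1q+\frac1{r'}=1$, and let $r$ be the exponent conjugate to $r'$, i.e. $\frac1r=1-\frac1{r'}=\frac1p+\frac1q$. Then $S^\delta$ is bounded from $L^p(\mathbb{R}^n)\times L^q(\mathbb{R}^n)$ to $L^r(\mathbb{R}^n)$, that is, it extends from pairs of Schwartz functions to a bounded bilinear operator $L^p(\mathbb{R}^n)\times L^q(\mathbb{R}^n)\to L^r(\mathbb{R}^n)$, in each of the following cases: (a) $p,q\in[2,\infty)$, $r'<2$ and $\delta>\frac{n-1}{2}+n\bigl(\frac1{r'}-\frac12\bigr)$; (b) $q,r'\in[2,\infty)$,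 $p<2$ and $\delta>n\bigl(\frac12-\frac1q\bigr)-\frac1{r'}$; (c) $p,r'\in[2,\infty)$, $q<2$ and $\delta>n\bigl(\frac12-\frac1p\bigr)-\frac1{r'}$. -/

import Mathlib

open MeasureTheory FourierTransform SchwartzMap

noncomputable section

/-- The bilinear Bochner-Riesz means of order `δ` on `ℝⁿ`, for Schwartz functions `f`, `g`:
`S^δ(f,g)(x) = ∬_{|ξ|² + |η|² ≤ 1} e^{2πi x·(ξ+η)} (1 - |ξ|² - |η|²)^δ f̂(ξ) ĝ(η) dξ dη`,
where `f̂(ξ) = ∫ e^{-2πi x·ξ} f(x) dx`. -/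
def bilinearBochnerRiesz (n : ℕ) (δ : ℝ) (f g : 𝓢(EuclideanSpace ℝ (Fin n), ℂ))
    (x : EuclideanSpace ℝ (Fin n)) : ℂ :=
  ∫ z : EuclideanSpace ℝ (Fin n) × EuclideanSpace ℝ (Fin n) in
      {z | ‖z.1‖ ^ 2 + ‖z.2‖ ^ 2 ≤ 1},
    Complex.exp (2 * Real.pi * Complex.I * (inner ℝ x (z.1 + z.2) : ℝ)) *
      (((1 - ‖z.1‖ ^ 2 - ‖z.2‖ ^ 2) ^ δ : ℝ) : ℂ) *
      (𝓕 (f : EuclideanSpace ℝ (Fin n) → ℂ) z.1) *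
      (𝓕 (g : EuclideanSpace ℝ (Fin n) → ℂ) z.2)

/-- An operator `S`, given on pairs of Schwartz functions, is bounded from
`L^p(ℝⁿ) × L^q(ℝⁿ)` to `L^r(ℝⁿ)`: there is a bilinear map `T : L^p × L^q → L^r` with
`‖T(F,G)‖_r ≤ C ‖F‖_p ‖G‖_q` for all `F ∈ L^p`, `G ∈ L^q`,
which agrees with `S` on Schwartz functions. The exponents are positive real numbers. -/
def IsBoundedBilinearOp (n : ℕ) (p q r : ℝ)
    (S : 𝓢(EuclideanSpace ℝ (Fin n), ℂ) → 𝓢(EuclideanSpace ℝ (Fin n), ℂ) →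
      EuclideanSpace ℝ (Fin n) → ℂ) : Prop :=
  ∃ (T : Lp (α := EuclideanSpace ℝ (Fin n)) ℂ (ENNReal.ofReal p) volume →ₗ[ℂ]
        Lp (α := EuclideanSpace ℝ (Fin n)) ℂ (ENNReal.ofReal q) volume →ₗ[ℂ]
        Lp (α := EuclideanSpace ℝ (Fin n)) ℂ (ENNReal.ofReal r) volume) (C : ℝ),
    (∀ F G, ‖T F G‖ ≤ C * ‖F‖ * ‖G‖) ∧
    ∀ f g : 𝓢(EuclideanSpace ℝ (Fin n), ℂ),
      (T (f.toLp (ENNReal.ofReal p) volume) (g.toLp (ENNReal.ofReal q) volume) :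
        EuclideanSpace ℝ (Fin n) → ℂ) =ᵐ[volume] S f g

end

/-! The symbol is cut dyadically by distance to the unit sphere of `V × V`: it equals the sum over
`j` of `2^(-jδ) φ(2^j(1-|ξ|²-|η|²))`, with `φ` smooth and supported in `[1/2, 2]`. With `t = 2^j`,
it suffices to bound each piece from `L^p × L^q` to `L^r` by a power of `t` smaller than `t^δ` and
sum geometric series.

Three facts give that power. (1) On the Fourier side the piece maps `L² × L²` to `L^s` with gain
`t^(-shellGain s)` (`exists_eLpNorm'_shell_le`). For `s = 2`, Cauchy–Schwarz on each fibre `ξ + η =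
ζ` gives `t^(-1/2)`, because the shell meets the fibre in an annulus of volume `O(1/t)`. For `s >
2`, the output spectrum lies in a fixed ball, so nothing is lost. For `s = 1`, Fourier inversion of
`φ` writes the symbol as a superposition of products `e(-τt|ξ|²) e(-τt|η|²)`, and Cauchy–Schwarz
with Plancherel gives a bound uniform in `t`. Between 1 and 2 the two bounds are interpolated.

(2) The symbol sees only frequencies in the unit ball. The `L²` norm there of the transform of a
function supported in a ball of radius `ρ` is controlled by its `L^p` norm, with no loss for `p ≤ 2`
and loss `ρ^(n(1/2-1/p))` for `p ≥ 2` (`exists_eLpNorm'_indicator_fourier_le`).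

(3) The convolution kernel has integral `O(1)` outside the ball of radius `R = t^(1+ε)`
(`exists_lintegral_shellKernel_tail_le`). Hence on a ball of radius `R` the operator depends, up to
this tail, on the restrictions of `f` and `g` to the doubled ball. Averaging the local bounds over
all centres, with Hölder since `r/p + r/q = 1`, gives the global bound.

The series converges when `δ > 0` and `ballLoss p + ballLoss q - shellGain r < δ`; in each of the
three cases this expression is exactly the stated threshold. -/

open scoped ENNReal NNReal RealInnerProductSpace

/-! ### Plancherel for the Fourier integral on `L¹ ∩ L²`. -/

section Plancherel

variable {V : Type*} [NormedAddCommGroup V] [InnerProductSpace ℝ V] [FiniteDimensional ℝ V]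
  [MeasurableSpace V] [BorelSpace V]

/-- On `L¹ ∩ L²` the Fourier integral agrees with the `L²` Fourier transform. -/
theorem fourier_toLp_two_ae_eq {f : V → ℂ} (hf : Integrable f) (hf2 : MemLp f 2) :
    ((𝓕 (hf2.toLp f) : Lp (α := V) ℂ 2) : V → ℂ) =ᵐ[volume] 𝓕 f := by
  have hcont : Continuous (𝓕 f) :=
    VectorFourier.fourierIntegral_continuous (μ := volume) Real.continuous_fourierChar
      (by exact continuous_inner) hf
  -- Tested against a smooth compactly supported `G`, both sides become the integral of `𝓕 G` times
  -- `f`: one by the distributional transform, the other by Fubini.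
  refine ae_eq_of_integral_contDiff_smul_eq
    ((Lp.memLp (𝓕 (hf2.toLp f) : Lp ℂ 2 (volume : Measure V))).locallyIntegrable (by norm_num))
    hcont.locallyIntegrable ?_
  intro g hg hgc
  have hg' : ContDiff ℝ (⊤ : ℕ∞) (fun x => (g x : ℂ)) := Complex.ofRealCLM.contDiff.comp hg
  have hgc' : HasCompactSupport (fun x => (g x : ℂ)) :=
    hgc.comp_left (g := fun t : ℝ => (t : ℂ)) (by simp)
  set G : 𝓢(V, ℂ) := hgc'.toSchwartzMap hg' with hG
  have h1 := congrArg (fun T => T G) (Lp.fourier_toTemperedDistribution_eq (hf2.toLp f))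
  simp only [TemperedDistribution.fourier_apply, Lp.toTemperedDistribution_apply] at h1
  have h2 : ∫ x, (𝓕 G) x • (hf2.toLp f : V → ℂ) x = ∫ x, (𝓕 G) x • f x :=
    integral_congr_ae (by filter_upwards [hf2.coeFn_toLp] with x hx; rw [hx])
  have h3 : ∫ ξ, (𝓕 (G : V → ℂ)) ξ • f ξ = ∫ x, G x • (𝓕 f) x := by
    have := VectorFourier.integral_fourierIntegral_smul_eq_flip (μ := (volume : Measure V))
      (ν := (volume : Measure V)) (L := innerₗ V) (f := (G : V → ℂ)) (g := f)
      Real.continuous_fourierChar (by exact continuous_inner) G.integrable hf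
    rw [flip_innerₗ] at this
    exact this
  rw [h2, SchwartzMap.fourier_coe, h3] at h1
  simpa [hG] using h1.symm

theorem lintegral_enorm_fourier_sq {f : V → ℂ} (hf : Integrable f) (hf2 : MemLp f 2) :
    ∫⁻ ξ, ‖𝓕 f ξ‖ₑ ^ (2 : ℝ) = ∫⁻ x, ‖f x‖ₑ ^ (2 : ℝ) := by
  have h1 : eLpNorm (𝓕 f) 2 volume = eLpNorm f 2 volume := by
    rw [← eLpNorm_congr_ae (fourier_toLp_two_ae_eq hf hf2), ← eLpNorm_congr_ae hf2.coeFn_toLp,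
      ← Lp.enorm_def, ← Lp.enorm_def, ← ofReal_norm, ← ofReal_norm, Lp.norm_fourier_eq]
  rw [eLpNorm_eq_lintegral_rpow_enorm_toReal (by norm_num) (by norm_num),
    eLpNorm_eq_lintegral_rpow_enorm_toReal (by norm_num) (by norm_num)] at h1
  simp only [ENNReal.toReal_ofNat] at h1
  exact (ENNReal.rpow_left_injective (by norm_num)) h1

theorem lintegral_enorm_fourierInv_sq {f : V → ℂ} (hf : Integrable f) (hf2 : MemLp f 2) :
    ∫⁻ ξ, ‖𝓕⁻ f ξ‖ₑ ^ (2 : ℝ) = ∫⁻ x, ‖f x‖ₑ ^ (2 : ℝ) := by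
  rw [← lintegral_enorm_fourier_sq hf hf2]
  simp_rw [Real.fourierInv_eq_fourier_neg]
  exact lintegral_neg_eq_self (fun ξ => ‖𝓕 f ξ‖ₑ ^ (2 : ℝ))

end Plancherel

/-! ### Interpolation of `L^s` norms of a single function. -/

section Interpolation

variable {α E : Type*} [MeasurableSpace α] {μ : Measure α} [NormedAddCommGroup E]

/-- Integrate the pointwise bound `|F|^s ≤ M^(s-2) |F|²`. -/
theorem eLpNorm'_le_of_enorm_le {F : α → E} (hF : AEStronglyMeasurable F μ) {s : ℝ} (hs : 2 ≤ s) {M : ℝ≥0∞}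
    (hM : ∀ x, ‖F x‖ₑ ≤ M) :
    eLpNorm' F s μ ≤ M ^ (1 - 2 / s) * eLpNorm' F 2 μ ^ (2 / s) := by
  have hs0 : 0 < s := by linarith
  have h : ∫⁻ x, ‖F x‖ₑ ^ s ∂μ ≤ M ^ (s - 2) * ∫⁻ x, ‖F x‖ₑ ^ (2 : ℝ) ∂μ := by
    have : ∀ x, ‖F x‖ₑ ^ s ≤ M ^ (s - 2) * ‖F x‖ₑ ^ (2 : ℝ) := fun x => by
      conv_lhs => rw [show s = (s - 2) + 2 by ring]
      rw [ENNReal.rpow_add_of_nonneg _ _ (by linarith) (by norm_num)]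
      gcongr ?_ * _
      exact ENNReal.rpow_le_rpow (hM x) (by linarith)
    rw [← lintegral_const_mul'' _ (hF.enorm.pow_const _)]
    exact lintegral_mono this
  rw [eLpNorm', eLpNorm', ← ENNReal.rpow_mul, show (1 : ℝ) / 2 * (2 / s) = 1 / s by field_simp]
  calc _ ≤ (M ^ (s - 2) * ∫⁻ x, ‖F x‖ₑ ^ (2 : ℝ) ∂μ) ^ (1 / s) := by gcongr
    _ = _ := by
      rw [ENNReal.mul_rpow_of_nonneg _ _ (by positivity), ← ENNReal.rpow_mul]
      congr 2; field_simp

/-- Hölder applied to `|F|^s = |F|^(2-s) (|F|²)^(s-1)`, whose exponents add up to 1. -/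
theorem eLpNorm'_le_interpolate_one_two {F : α → E} (hF : AEStronglyMeasurable F μ) {s : ℝ}
    (hs1 : 1 ≤ s) (hs2 : s ≤ 2) :
    eLpNorm' F s μ ≤ eLpNorm' F 1 μ ^ (2 / s - 1) * eLpNorm' F 2 μ ^ (2 - 2 / s) := by
  have hs0 : 0 < s := by linarith
  have h := ENNReal.lintegral_mul_norm_pow_le (μ := μ) (f := fun x => ‖F x‖ₑ)
    (g := fun x => ‖F x‖ₑ ^ (2 : ℝ)) hF.enorm (hF.enorm.pow_const _) (p := 2 - s) (q := s - 1)
    (by linarith) (by linarith) (by ring)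
  have h' : ∀ x, ‖F x‖ₑ ^ (2 - s) * (‖F x‖ₑ ^ (2 : ℝ)) ^ (s - 1) = ‖F x‖ₑ ^ s := fun x => by
    rw [← ENNReal.rpow_mul, ← ENNReal.rpow_add_of_nonneg _ _ (by linarith) (by linarith)]
    congr 1; ring
  simp_rw [h'] at h
  simp only [eLpNorm', ENNReal.rpow_one, div_one]
  calc _ ≤ ((∫⁻ x, ‖F x‖ₑ ∂μ) ^ (2 - s) * (∫⁻ x, ‖F x‖ₑ ^ (2 : ℝ) ∂μ) ^ (s - 1)) ^ (1 / s) := by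
        gcongr
    _ = _ := by
      rw [ENNReal.mul_rpow_of_nonneg _ _ (by positivity), ← ENNReal.rpow_mul, ← ENNReal.rpow_mul,
        ← ENNReal.rpow_mul]
      congr 2 <;> field_simp

end Interpolation

/-! ### Fourier transform estimates on sets of finite volume. -/

section Restriction

variable {V : Type*} [NormedAddCommGroup V] [InnerProductSpace ℝ V] [FiniteDimensional ℝ V]
  [MeasurableSpace V] [BorelSpace V]

theorem enorm_fourier_le (G : V → ℂ) (x : V) : ‖𝓕 G x‖ₑ ≤ ∫⁻ y, ‖G y‖ₑ := by
  rw [Real.fourier_eq]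
  refine (enorm_integral_le_lintegral_enorm _).trans_eq ?_
  refine lintegral_congr fun y => ?_
  rw [← ofReal_norm, Circle.norm_smul, ofReal_norm]

theorem continuous_fourier {f : V → ℂ} (hf : Integrable f) : Continuous (𝓕 f) :=
  VectorFourier.fourierIntegral_continuous Real.continuous_fourierChar
    (by exact continuous_inner) hf

theorem lintegral_enorm_le_of_support {G : V → ℂ} (hG : AEStronglyMeasurable G) {B : Set V}
    (hB : MeasurableSet B) (hGB : ∀ x ∉ B, G x = 0) :
    ∫⁻ y, ‖G y‖ₑ ≤ volume B ^ (1 / 2 : ℝ) * eLpNorm' G 2 volume := by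
  have h := ENNReal.lintegral_mul_le_Lp_mul_Lq (volume : Measure V) Real.HolderConjugate.two_two
    (f := B.indicator 1) (g := fun x => ‖G x‖ₑ) (measurable_one.indicator hB).aemeasurable hG.enorm
  refine le_trans (le_of_eq ?_) (h.trans_eq ?_)
  · refine lintegral_congr fun x => ?_
    by_cases hx : x ∈ B <;> simp [hx, hGB]
  · rw [eLpNorm']
    congr 2
    rw [← lintegral_indicator_one hB]
    refine lintegral_congr fun x => ?_
    by_cases hx : x ∈ B <;> simp [hx]

/-- The dual restriction estimate `L²(B) → L^s`, `s ≥ 2`, for the Fourier transform. -/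
theorem eLpNorm'_fourier_le_of_support {G : V → ℂ} (hG : Integrable G) (hG2 : MemLp G 2)
    {B : Set V} (hB : MeasurableSet B) (hGB : ∀ x ∉ B, G x = 0) {s : ℝ} (hs : 2 ≤ s) :
    eLpNorm' (𝓕 G) s volume ≤ volume B ^ (1 / 2 - 1 / s) * eLpNorm' G 2 volume := by
  have hs0 : 0 < s := by linarith
  have hs1 : 2 / s ≤ 1 := by rw [div_le_one hs0]; exact hs
  have h2 : eLpNorm' (𝓕 G) 2 volume = eLpNorm' G 2 volume := by
    rw [eLpNorm', lintegral_enorm_fourier_sq hG hG2, eLpNorm']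
  -- Plancherel is interpolated with the sup bound `‖𝓕 G‖_∞ ≤ ‖G‖₁ ≤ |B|^(1/2) ‖G‖₂`.
  refine (eLpNorm'_le_of_enorm_le (continuous_fourier hG).aestronglyMeasurable hs fun x => (enorm_fourier_le G x).trans
    (lintegral_enorm_le_of_support hG.1 hB hGB)).trans_eq ?_
  rw [h2, ENNReal.mul_rpow_of_nonneg _ _ (by linarith), ← ENNReal.rpow_mul, mul_assoc,
    ← ENNReal.rpow_add_of_nonneg _ _ (by linarith) (by positivity)]
  simp only [sub_add_cancel, ENNReal.rpow_one]
  congr 2; field_simp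

/-- The restriction estimate `L^p → L²(B)`, `1 < p ≤ 2`, for the Fourier transform. -/
theorem eLpNorm'_indicator_fourier_le {p p' : ℝ} (hp : p.HolderConjugate p') (hp2 : p ≤ 2)
    {B : Set V} (hB : MeasurableSet B) (hBv : volume B ≠ ⊤) {u : V → ℂ} (hu : Integrable u) :
    eLpNorm' (B.indicator (𝓕 u)) 2 volume ≤
      volume B ^ (1 / 2 - 1 / p') * eLpNorm' u p volume := by
  have hp' : 2 ≤ p' := by
    have h1 := hp.inv_add_inv_eq_one
    have := hp.pos; have := hp.symm.pos
    field_simp at h1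
    nlinarith [hp.lt, hp.symm.lt]
  -- Duality: pairing `𝓕 u` with this `G` gives `‖G‖₂²`; moving the transform onto `G` makes the
  -- dual estimate available, after which one factor `‖G‖₂` is cancelled.
  set G : V → ℂ := B.indicator fun ξ => (starRingEnd ℂ) (𝓕 u ξ) with hGdef
  have hcont := continuous_fourier hu
  have hGm : AEStronglyMeasurable G volume :=
    ((Complex.continuous_conj.comp hcont).aestronglyMeasurable).indicator hB
  have hGle : ∀ x, ‖G x‖ ≤ (∫⁻ y, ‖u y‖ₑ).toReal := fun x => by
    by_cases hx : x ∈ B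
    · simp only [hGdef, Set.indicator_of_mem hx, RCLike.norm_conj]
      rw [← toReal_enorm]
      exact ENNReal.toReal_mono hu.2.ne (enorm_fourier_le u x)
    · simp [hGdef, hx]
  have hGB : ∀ x ∉ B, G x = 0 := fun x hx => by simp [hGdef, hx]
  have hGp : ∀ s : ℝ≥0∞, MemLp G s := fun s => by
    have h1 : MemLp (B.indicator fun _ => (∫⁻ y, ‖u y‖ₑ).toReal) s volume :=
      memLp_indicator_const s hB _ (Or.inr hBv)
    refine h1.mono hGm (Filter.Eventually.of_forall fun x => ?_)
    by_cases hx : x ∈ B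
    · simpa [hx] using (hGle x).trans (le_abs_self _)
    · simp [hx, hGB]
  have hGi : Integrable G := memLp_one_iff_integrable.1 (hGp 1)
  have hN : eLpNorm' (B.indicator (𝓕 u)) 2 volume = eLpNorm' G 2 volume := by
    simp only [eLpNorm']
    congr 2; ext x
    by_cases hx : x ∈ B <;> simp [hGdef, hx]
  have hfin : eLpNorm' G 2 volume ≠ ⊤ := by
    have := (hGp 2).2.ne
    rwa [eLpNorm_eq_eLpNorm' (by norm_num) (by norm_num)] at this
  have hkey : eLpNorm' G 2 volume * eLpNorm' G 2 volume ≤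
      eLpNorm' u p volume * (volume B ^ (1 / 2 - 1 / p') * eLpNorm' G 2 volume) := by
    have hflip : ∫ ξ, (𝓕 u ξ) • (G ξ) = ∫ x, u x • 𝓕 G x := by
      have := VectorFourier.integral_fourierIntegral_smul_eq_flip (μ := (volume : Measure V))
        (ν := (volume : Measure V)) (L := innerₗ V) (f := u) (g := G)
        Real.continuous_fourierChar (by exact continuous_inner) hu hGi
      rwa [flip_innerₗ] at this
    have hsq : ∀ ξ, (𝓕 u ξ) • (G ξ) = ((‖G ξ‖ ^ 2 : ℝ) : ℂ) := fun ξ => by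
      by_cases hx : ξ ∈ B
      · simp [hGdef, hx, Complex.mul_conj, Complex.normSq_eq_norm_sq]
      · simp [hGB, hx]
    have hL : eLpNorm' G 2 volume * eLpNorm' G 2 volume = ‖∫ ξ, (𝓕 u ξ) • (G ξ)‖ₑ := by
      simp_rw [hsq]
      rw [integral_complex_ofReal, ← ofReal_norm, Complex.norm_real, Real.norm_of_nonneg
        (integral_nonneg fun _ => by positivity), ofReal_integral_eq_lintegral_ofReal
        ((hGp 2).integrable_norm_pow (by norm_num)) (.of_forall fun _ => by positivity),
        eLpNorm', ← ENNReal.rpow_add_of_nonneg _ _ (by norm_num) (by norm_num)]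
      norm_num
    rw [hL, hflip]
    refine (enorm_integral_le_lintegral_enorm _).trans ?_
    simp_rw [smul_eq_mul, enorm_mul]
    refine (ENNReal.lintegral_mul_le_Lp_mul_Lq volume hp hu.1.enorm
      (continuous_fourier hGi).enorm.aemeasurable).trans ?_
    have := eLpNorm'_fourier_le_of_support hGi (hGp 2) hB hGB hp'
    rw [eLpNorm'] at this ⊢
    gcongr
  rw [hN]
  by_cases h0 : eLpNorm' G 2 volume = 0
  · rw [h0]; exact zero_le
  · rw [← mul_assoc] at hkey
    rw [mul_comm _ (eLpNorm' u p volume)]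
    exact (ENNReal.mul_le_mul_iff_left h0 hfin).1 hkey

end Restriction

/-! ### Bilinear multipliers on `L² × L²`. -/

section BilinearMultiplier

variable {V : Type*} [NormedAddCommGroup V] [InnerProductSpace ℝ V] [FiniteDimensional ℝ V]
  [MeasurableSpace V] [BorelSpace V]

theorem continuous_fourierChar_coe {X : Type*} [TopologicalSpace X] {g : X → ℝ}
    (hg : Continuous g) : Continuous fun x => ((Real.fourierChar (g x) : Circle) : ℂ) :=
  continuous_subtype_val.comp (Real.continuous_fourierChar.comp hg)

theorem enorm_circle_smul (c : Circle) (z : ℂ) : ‖c • z‖ₑ = ‖z‖ₑ := by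
  rw [← ofReal_norm, Circle.norm_smul, ofReal_norm]

theorem aestronglyMeasurable_fourierChar_smul {X : Type*} [TopologicalSpace X] [MeasurableSpace X]
    [OpensMeasurableSpace X] {μ : Measure X} {g : X → ℝ} {f : X → ℂ}
    (hg : Continuous g) (hf : AEStronglyMeasurable f μ) :
    AEStronglyMeasurable (fun x => Real.fourierChar (g x) • f x) μ := by
  simp_rw [Circle.smul_def]
  exact (continuous_fourierChar_coe hg).aestronglyMeasurable.smul hf

theorem integrable_fourierChar_smul {X : Type*} [TopologicalSpace X] [MeasurableSpace X]
    [OpensMeasurableSpace X] {μ : Measure X} {g : X → ℝ} {f : X → ℂ}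
    (hg : Continuous g) (hf : Integrable f μ) :
    Integrable (fun x => Real.fourierChar (g x) • f x) μ :=
  hf.mono (aestronglyMeasurable_fourierChar_smul hg hf.1)
    (.of_forall fun x => by simp [Circle.norm_smul])

theorem memLp_fourierChar_smul {X : Type*} [TopologicalSpace X] [MeasurableSpace X]
    [OpensMeasurableSpace X] {μ : Measure X} {g : X → ℝ} {f : X → ℂ}
    {s : ℝ≥0∞} (hg : Continuous g) (hf : MemLp f s μ) :
    MemLp (fun x => Real.fourierChar (g x) • f x) s μ :=
  hf.mono (aestronglyMeasurable_fourierChar_smul hg hf.1)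
    (.of_forall fun x => by simp [Circle.norm_smul])

/-- The bilinear multiplier operator with symbol `m`, acting on the Fourier side. -/
noncomputable def bilinearMultiplier (m : V × V → ℂ) (U W : V → ℂ) (x : V) : ℂ :=
  ∫ z : V × V, Real.fourierChar ⟪x, z.1 + z.2⟫ • (m z * U z.1 * W z.2)

theorem lintegral_mul_le_eLpNorm'_two {α : Type*} [MeasurableSpace α] {μ : Measure α}
    {f g : α → ℂ} (hf : AEStronglyMeasurable f μ) (hg : AEStronglyMeasurable g μ) :
    ∫⁻ x, ‖f x‖ₑ * ‖g x‖ₑ ∂μ ≤ eLpNorm' f 2 μ * eLpNorm' g 2 μ :=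
  ENNReal.lintegral_mul_le_Lp_mul_Lq μ Real.HolderConjugate.two_two hf.enorm hg.enorm

theorem eLpNorm'_two_rpow {α : Type*} [MeasurableSpace α] {μ : Measure α} (f : α → ℂ) :
    eLpNorm' f 2 μ ^ (2 : ℝ) = ∫⁻ x, ‖f x‖ₑ ^ (2 : ℝ) ∂μ := by
  rw [eLpNorm', ← ENNReal.rpow_mul]; norm_num

theorem integrable_symbol_mul {m : V × V → ℂ} {U W : V → ℂ} {M : ℝ} (hm : Continuous m)
    (hmb : ∀ z, ‖m z‖ ≤ M) (hU : Integrable U) (hW : Integrable W) :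
    Integrable fun z : V × V => m z * U z.1 * W z.2 := by
  simp_rw [mul_assoc]
  exact (hU.mul_prod hW).bdd_mul hm.aestronglyMeasurable (Filter.Eventually.of_forall hmb)

/-- The Fourier side of `bilinearMultiplier m U W`. -/
noncomputable def twistedConv (m : V × V → ℂ) (U W : V → ℂ) (ζ : V) : ℂ :=
  ∫ ξ, m (ξ, ζ - ξ) * U ξ * W (ζ - ξ)

theorem integrable_twisted {m : V × V → ℂ} {U W : V → ℂ} {M : ℝ} (hm : Continuous m)
    (hmb : ∀ z, ‖m z‖ ≤ M) (hU : Integrable U) (hW : Integrable W) :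
    Integrable fun z : V × V => m (z.1, z.2 - z.1) * U z.1 * W (z.2 - z.1) := by
  have h := (measurePreserving_prod_sub (volume : Measure V) (volume : Measure V))
  exact h.integrable_comp_of_integrable (integrable_symbol_mul hm hmb hU hW)

theorem integrable_twistedConv {m : V × V → ℂ} {U W : V → ℂ} {M : ℝ} (hm : Continuous m)
    (hmb : ∀ z, ‖m z‖ ≤ M) (hU : Integrable U) (hW : Integrable W) :
    Integrable (twistedConv m U W) :=
  (integrable_twisted hm hmb hU hW).integral_prod_right

/-- Fubini after the substitution `ζ = ξ + η` on each line of fixed `ξ`. -/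
theorem bilinearMultiplier_eq_fourierInv {m : V × V → ℂ} {U W : V → ℂ} {M : ℝ} (hm : Continuous m)
    (hmb : ∀ z, ‖m z‖ ≤ M) (hU : Integrable U) (hW : Integrable W) :
    bilinearMultiplier m U W = 𝓕⁻ (twistedConv m U W) := by
  ext x
  rw [Real.fourierInv_eq]
  have hi1 : Integrable fun z : V × V =>
      Real.fourierChar ⟪x, z.1 + z.2⟫ • (m z * U z.1 * W z.2) :=
    integrable_fourierChar_smul (by fun_prop) (integrable_symbol_mul hm hmb hU hW)
  have hi2 : Integrable fun z : V × V =>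
      Real.fourierChar ⟪x, z.2⟫ • (m (z.1, z.2 - z.1) * U z.1 * W (z.2 - z.1)) :=
    integrable_fourierChar_smul (by fun_prop) (integrable_twisted hm hmb hU hW)
  rw [bilinearMultiplier, Measure.volume_eq_prod, integral_prod _ hi1]
  have : ∀ ξ : V, (∫ η, Real.fourierChar ⟪x, ξ + η⟫ • (m (ξ, η) * U ξ * W η)) =
      ∫ ζ, Real.fourierChar ⟪x, ζ⟫ • (m (ξ, ζ - ξ) * U ξ * W (ζ - ξ)) := fun ξ => by
    rw [← integral_sub_right_eq_self _ ξ]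
    simp
  simp_rw [this]
  rw [integral_integral_swap hi2]
  refine integral_congr_ae (.of_forall fun ζ => ?_)
  simp only [twistedConv, Circle.smul_def, integral_smul, real_inner_comm]

/-- Cauchy–Schwarz on the fibre `ξ + η = ζ` separates the symbol from `U(ξ) W(ζ - ξ)`; integrating
the square of the latter over `ζ` and `ξ` factors into `‖U‖₂² ‖W‖₂²`. -/
theorem eLpNorm'_twistedConv_le {m : V × V → ℂ} {U W : V → ℂ} {D : ℝ≥0∞}
    (hm : Continuous m) (hU : Integrable U) (hW : Integrable W)
    (hD : ∀ ζ, ∫⁻ ξ, ‖m (ξ, ζ - ξ)‖ₑ ^ (2 : ℝ) ≤ D ^ (2 : ℝ)) :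
    eLpNorm' (twistedConv m U W) 2 volume ≤ D * (eLpNorm' U 2 volume * eLpNorm' W 2 volume) := by
  have hUW : AEMeasurable (fun z : V × V => ‖U z.2‖ₑ ^ (2 : ℝ) * ‖W (z.1 - z.2)‖ₑ ^ (2 : ℝ))
      (volume.prod volume) := by
    have h := (measurePreserving_sub_prod (volume : Measure V) (volume : Measure V))
    have h1 : AEMeasurable (fun z : V × V => ‖W z.1‖ₑ ^ (2 : ℝ)) (volume.prod volume) :=
      (hW.1.enorm.pow_const _).comp_fst
    exact ((hU.1.enorm.pow_const _).comp_snd).mul (h1.comp_quasiMeasurePreserving h.quasiMeasurePreserving)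
  have hpt : ∀ ζ, ‖twistedConv m U W ζ‖ₑ ^ (2 : ℝ) ≤
      D ^ (2 : ℝ) * ∫⁻ ξ, ‖U ξ‖ₑ ^ (2 : ℝ) * ‖W (ζ - ξ)‖ₑ ^ (2 : ℝ) := fun ζ => by
    have hWζ : AEStronglyMeasurable (fun ξ => W (ζ - ξ)) volume :=
      hW.1.comp_quasiMeasurePreserving (quasiMeasurePreserving_sub_left volume ζ)
    have h1 : ‖twistedConv m U W ζ‖ₑ ≤ eLpNorm' (fun ξ => m (ξ, ζ - ξ)) 2 volume *
        eLpNorm' (fun ξ => U ξ * W (ζ - ξ)) 2 volume := by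
      refine (enorm_integral_le_lintegral_enorm _).trans ?_
      simp_rw [mul_assoc]
      refine le_trans (le_of_eq ?_) (lintegral_mul_le_eLpNorm'_two
        (by fun_prop : Continuous fun ξ => m (ξ, ζ - ξ)).aestronglyMeasurable (hU.1.mul hWζ))
      simp [enorm_mul]
    refine (ENNReal.rpow_le_rpow h1 (by norm_num)).trans ?_
    rw [ENNReal.mul_rpow_of_nonneg _ _ (by norm_num), eLpNorm'_two_rpow, eLpNorm'_two_rpow]
    refine mul_le_mul' (hD ζ) (le_of_eq ?_)
    simp_rw [enorm_mul, ENNReal.mul_rpow_of_nonneg _ _ (zero_le_two : (0:ℝ) ≤ 2)]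
  have hsq : ∫⁻ ζ, ‖twistedConv m U W ζ‖ₑ ^ (2 : ℝ) ≤
      D ^ (2 : ℝ) * ((∫⁻ ξ, ‖U ξ‖ₑ ^ (2 : ℝ)) * ∫⁻ ξ, ‖W ξ‖ₑ ^ (2 : ℝ)) := by
    refine (lintegral_mono hpt).trans_eq ?_
    rw [lintegral_const_mul'' _ hUW.lintegral_prod_right', lintegral_lintegral_swap hUW]
    congr 1
    rw [← lintegral_mul_const'' _ (hU.1.enorm.pow_const _)]
    refine lintegral_congr fun ξ => ?_
    have hWξ : AEMeasurable (fun ζ => ‖W (ζ - ξ)‖ₑ ^ (2 : ℝ)) volume :=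
      (hW.1.enorm.pow_const _).comp_quasiMeasurePreserving
        (measurePreserving_sub_right volume ξ).quasiMeasurePreserving
    simp only
    rw [lintegral_const_mul'' _ hWξ, lintegral_sub_right_eq_self (fun ζ => ‖W ζ‖ₑ ^ (2 : ℝ))]
  rw [eLpNorm', eLpNorm', eLpNorm', ← ENNReal.mul_rpow_of_nonneg _ _ (by norm_num)]
  refine (ENNReal.rpow_le_rpow hsq (by norm_num)).trans_eq ?_
  rw [ENNReal.mul_rpow_of_nonneg _ _ (by norm_num), ← ENNReal.rpow_mul]
  norm_num

/-- `L² × L² → L^s` bounds, `s ≥ 2`, for symbols whose square integrals on the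
affine subspaces `ξ + η = ζ` are bounded. -/
theorem eLpNorm'_bilinearMultiplier_le_of_two_le {m : V × V → ℂ} {U W : V → ℂ} {M : ℝ} {D : ℝ≥0∞}
    (hm : Continuous m) (hmb : ∀ z, ‖m z‖ ≤ M) (hU : Integrable U) (hW : Integrable W)
    (hU2 : MemLp U 2) (hW2 : MemLp W 2) (hDt : D ≠ ⊤)
    (hD : ∀ ζ, ∫⁻ ξ, ‖m (ξ, ζ - ξ)‖ₑ ^ (2 : ℝ) ≤ D ^ (2 : ℝ))
    {B : Set V} (hB : MeasurableSet B) (hmB : ∀ z : V × V, z.1 + z.2 ∉ B → m z = 0)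
    {s : ℝ} (hs : 2 ≤ s) :
    eLpNorm' (bilinearMultiplier m U W) s volume ≤
      volume B ^ (1 / 2 - 1 / s) * (D * (eLpNorm' U 2 volume * eLpNorm' W 2 volume)) := by
  have hH := integrable_twistedConv hm hmb hU hW
  have hle := eLpNorm'_twistedConv_le hm hU hW hD
  have h2 : ∀ {f : V → ℂ}, MemLp f 2 → eLpNorm' f 2 volume ≠ ⊤ := fun hf => by
    have := hf.2.ne
    rwa [eLpNorm_eq_eLpNorm' (by norm_num) (by norm_num)] at this
  have hH2 : MemLp (twistedConv m U W) 2 := by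
    refine ⟨hH.1, ?_⟩
    rw [eLpNorm_eq_eLpNorm' (by norm_num) (by norm_num), ENNReal.toReal_ofNat]
    exact hle.trans_lt (ENNReal.mul_lt_top hDt.lt_top
      (ENNReal.mul_lt_top (h2 hU2).lt_top (h2 hW2).lt_top))
  have hHB : ∀ ζ ∉ B, twistedConv m U W ζ = 0 := fun ζ hζ => by
    rw [twistedConv]
    refine integral_eq_zero_of_ae (.of_forall fun ξ => ?_)
    simp [hmB (ξ, ζ - ξ) (by simpa using hζ)]
  rw [bilinearMultiplier_eq_fourierInv hm hmb hU hW]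
  have hneg : eLpNorm' (𝓕⁻ (twistedConv m U W)) s volume =
      eLpNorm' (𝓕 (twistedConv m U W)) s volume := by
    simp only [eLpNorm', Real.fourierInv_eq_fourier_neg]
    rw [lintegral_neg_eq_self (fun ξ => ‖𝓕 (twistedConv m U W) ξ‖ₑ ^ s)]
  rw [hneg]
  refine (eLpNorm'_fourier_le_of_support hH hH2 hB hHB hs).trans ?_
  gcongr

/-- The inverse Fourier transform of `e^{2πiτa} U`. -/
noncomputable def modulatedInv (a : V → ℝ) (U : V → ℂ) (τ : ℝ) : V → ℂ :=
  𝓕⁻ fun ξ => Real.fourierChar (τ * a ξ) • U ξ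

theorem eLpNorm'_modulatedInv {a : V → ℝ} (ha : Continuous a) {U : V → ℂ} (hU : Integrable U)
    (hU2 : MemLp U 2) (τ : ℝ) :
    eLpNorm' (modulatedInv a U τ) 2 volume = eLpNorm' U 2 volume := by
  rw [eLpNorm', modulatedInv, lintegral_enorm_fourierInv_sq
    (integrable_fourierChar_smul (by fun_prop) hU) (memLp_fourierChar_smul (by fun_prop) hU2),
    eLpNorm']
  simp_rw [enorm_circle_smul]

theorem continuous_modulatedInv {a : V → ℝ} (ha : Continuous a) {U : V → ℂ} (hU : Integrable U) :
    Continuous fun w : V × ℝ => modulatedInv a U w.2 w.1 := by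
  simp only [modulatedInv, Real.fourierInv_eq]
  refine continuous_of_dominated (bound := fun ξ => ‖U ξ‖) (fun w => ?_) (fun w => ?_) hU.norm ?_
  · exact aestronglyMeasurable_fourierChar_smul (by fun_prop)
      (aestronglyMeasurable_fourierChar_smul (by fun_prop) hU.1)
  · exact .of_forall fun ξ => by simp [Circle.norm_smul]
  · refine .of_forall fun ξ => ?_
    simp_rw [Circle.smul_def]
    exact (continuous_fourierChar_coe (by fun_prop)).smul
      ((continuous_fourierChar_coe (by fun_prop)).smul continuous_const)

theorem continuous_modulatedInv_apply {a : V → ℝ} (ha : Continuous a) {U : V → ℂ}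
    (hU : Integrable U) (τ : ℝ) : Continuous (modulatedInv a U τ) :=
  Continuous.comp (g := fun w : V × ℝ => modulatedInv a U w.2 w.1) (f := fun x => (x, τ))
    (continuous_modulatedInv ha hU) (by fun_prop)

/-- `L² × L² → L¹` bound for superpositions of tensor products of unimodular symbols. -/
theorem eLpNorm'_one_bilinearMultiplier_le {m : V × V → ℂ} {U W : V → ℂ} {k : ℝ → ℂ} {a : V → ℝ}
    (hk : Integrable k) (ha : Continuous a)
    (hm : ∀ z : V × V, m z = ∫ τ, Real.fourierChar (τ * (a z.1 + a z.2)) • k τ)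
    (hU : Integrable U) (hW : Integrable W) (hU2 : MemLp U 2) (hW2 : MemLp W 2) :
    eLpNorm' (bilinearMultiplier m U W) 1 volume ≤
      (∫⁻ τ, ‖k τ‖ₑ) * (eLpNorm' U 2 volume * eLpNorm' W 2 volume) := by
  let A : (V → ℂ) → ℝ → V → ℂ := modulatedInv a
  -- For fixed `τ` the symbol is a tensor product, so the operator is the pointwise product of two
  -- modulated inverse transforms. Cauchy–Schwarz in `x` and Plancherel then bound its `L¹` norm
  -- uniformly in `τ`.
  have hT : ∀ x, bilinearMultiplier m U W x = ∫ τ, k τ * (A U τ x * A W τ x) := fun x => by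
    have hint : Integrable (fun y : (V × V) × ℝ => Real.fourierChar ⟪x, y.1.1 + y.1.2⟫ •
        (Real.fourierChar (y.2 * (a y.1.1 + a y.1.2)) • (U y.1.1 * W y.1.2 * k y.2)))
        ((volume.prod volume).prod volume) := by
      exact integrable_fourierChar_smul (by fun_prop) (integrable_fourierChar_smul (by fun_prop)
        ((hU.mul_prod hW).mul_prod hk))
    calc bilinearMultiplier m U W x
        = ∫ z : V × V, ∫ τ, Real.fourierChar ⟪x, z.1 + z.2⟫ •
          (Real.fourierChar (τ * (a z.1 + a z.2)) • (U z.1 * W z.2 * k τ)) := by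
          refine integral_congr_ae (.of_forall fun z => ?_)
          simp only [hm z, Circle.smul_def, smul_eq_mul]
          rw [← integral_mul_const, ← integral_mul_const, ← integral_const_mul]
          refine integral_congr_ae (.of_forall fun τ => ?_)
          ring
      _ = ∫ τ, ∫ z : V × V, Real.fourierChar ⟪x, z.1 + z.2⟫ •
          (Real.fourierChar (τ * (a z.1 + a z.2)) • (U z.1 * W z.2 * k τ)) :=
          integral_integral_swap hint
      _ = _ := by
          refine integral_congr_ae (.of_forall fun τ => ?_)
          simp only [A, modulatedInv, Real.fourierInv_eq]
          rw [← integral_prod_mul, ← integral_const_mul]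
          refine integral_congr_ae (.of_forall fun z => ?_)
          simp only [inner_add_right, mul_add, AddChar.map_add_eq_mul, Circle.smul_def,
            Circle.coe_mul, smul_eq_mul, real_inner_comm]
          ring
  have hAc : ∀ {U : V → ℂ}, Integrable U → Measurable fun w : V × ℝ => ‖A U w.2 w.1‖ₑ :=
    fun hU => (continuous_modulatedInv ha hU).enorm.measurable
  have hmeas : AEMeasurable (fun w : V × ℝ => ‖k w.2‖ₑ * (‖A U w.2 w.1‖ₑ * ‖A W w.2 w.1‖ₑ))
      (volume.prod volume) :=
    hk.1.enorm.comp_snd.mul ((hAc hU).mul (hAc hW)).aemeasurable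
  simp only [eLpNorm', ENNReal.rpow_one, div_one]
  calc ∫⁻ x, ‖bilinearMultiplier m U W x‖ₑ
      ≤ ∫⁻ x, ∫⁻ τ, ‖k τ‖ₑ * (‖A U τ x‖ₑ * ‖A W τ x‖ₑ) := by
        refine lintegral_mono fun x => ?_
        rw [hT x]
        refine (enorm_integral_le_lintegral_enorm _).trans_eq ?_
        simp_rw [enorm_mul]
    _ = ∫⁻ τ, ∫⁻ x, ‖k τ‖ₑ * (‖A U τ x‖ₑ * ‖A W τ x‖ₑ) := lintegral_lintegral_swap hmeas
    _ ≤ ∫⁻ τ, ‖k τ‖ₑ * (eLpNorm' U 2 volume * eLpNorm' W 2 volume) := by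
        refine lintegral_mono fun τ => ?_
        have hcU := continuous_modulatedInv_apply ha hU τ
        have hcW := continuous_modulatedInv_apply ha hW τ
        have hmul : Measurable fun x => ‖A U τ x‖ₑ * ‖A W τ x‖ₑ :=
          hcU.enorm.measurable.mul hcW.enorm.measurable
        rw [lintegral_const_mul _ hmul]
        gcongr
        refine (lintegral_mul_le_eLpNorm'_two hcU.aestronglyMeasurable
          hcW.aestronglyMeasurable).trans_eq ?_
        rw [eLpNorm'_modulatedInv ha hU hU2, eLpNorm'_modulatedInv ha hW hW2]
    _ = _ := lintegral_mul_const'' _ hk.1.enorm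

end BilinearMultiplier

/-- A power `r^n` with `n ≥ 2` is a Lipschitz function of `r²` on `[0, 1]`. This fails for `n = 1`,
and it is what makes thin annuli have volume proportional to their width in `r²`. -/
theorem pow_sub_pow_le_sq_sub_sq {a b : ℝ} (ha : 0 ≤ a) (hab : a ≤ b) (hb : b ≤ 1) (k : ℕ) :
    b ^ (k + 2) - a ^ (k + 2) ≤ (k + 1) * (b ^ 2 - a ^ 2) := by
  induction k with
  | zero => simp
  | succ k ih =>
    have h1 : a ^ (k + 2) ≤ a := by
      simpa using pow_le_pow_of_le_one ha (hab.trans hb) (show 1 ≤ k + 2 by omega)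
    have h2 : 0 ≤ b ^ (k + 2) - a ^ (k + 2) := sub_nonneg.2 (pow_le_pow_left₀ ha hab _)
    have h3 : a ^ (k + 2) * (b - a) ≤ (b + a) * (b - a) := by
      gcongr
      linarith
    have h4 : b * (b ^ (k + 2) - a ^ (k + 2)) ≤ 1 * (b ^ (k + 2) - a ^ (k + 2)) := by gcongr
    have h5 : 0 ≤ b ^ 2 - a ^ 2 := sub_nonneg.2 (pow_le_pow_left₀ ha hab _)
    push_cast
    calc b ^ (k + 1 + 2) - a ^ (k + 1 + 2)
        = b * (b ^ (k + 2) - a ^ (k + 2)) + a ^ (k + 2) * (b - a) := by ring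
      _ ≤ (k + 1) * (b ^ 2 - a ^ 2) + (b ^ 2 - a ^ 2) := by nlinarith
      _ = (k + 1 + 1) * (b ^ 2 - a ^ 2) := by ring

/-! ### The symbol of a thin spherical shell. -/

section Symbol

variable {V : Type*} [NormedAddCommGroup V]

/-- The symbol `φ(t(1 - |ξ|² - |η|²))`. -/
noncomputable def shellSymbol (φ : 𝓢(ℝ, ℂ)) (t : ℝ) (z : V × V) : ℂ :=
  φ (t * (1 - ‖z.1‖ ^ 2 - ‖z.2‖ ^ 2))

theorem continuous_shellSymbol (φ : 𝓢(ℝ, ℂ)) (t : ℝ) :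
    Continuous (shellSymbol φ t : V × V → ℂ) :=
  φ.continuous.comp (by fun_prop)

theorem exists_norm_shellSymbol_le (φ : 𝓢(ℝ, ℂ)) :
    ∃ M : ℝ, 0 ≤ M ∧ ∀ (t : ℝ) (z : V × V), ‖shellSymbol φ t z‖ ≤ M :=
  ⟨_, apply_nonneg _ _, fun _ _ => SchwartzMap.norm_le_seminorm ℝ φ _⟩

theorem shellSymbol_eq_zero {φ : 𝓢(ℝ, ℂ)} (hφ : ∀ u ∉ Set.Icc (1 / 2 : ℝ) 2, φ u = 0) {t : ℝ}
    (ht : 0 ≤ t) {z : V × V} (hz : 1 < ‖z.1‖ ^ 2 + ‖z.2‖ ^ 2) : shellSymbol φ t z = 0 := by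
  refine hφ _ fun h => ?_
  have := mul_nonneg ht (sub_nonneg.2 hz.le)
  linarith [h.1]

theorem shellSymbol_ne_zero {φ : 𝓢(ℝ, ℂ)} (hφ : ∀ u ∉ Set.Icc (1 / 2 : ℝ) 2, φ u = 0) {t : ℝ}
    (ht : 0 ≤ t) {z : V × V} (hz : shellSymbol φ t z ≠ 0) :
    z.1 ∈ Metric.closedBall (0 : V) 1 ∧ z.2 ∈ Metric.closedBall (0 : V) 1 := by
  have h : ‖z.1‖ ^ 2 + ‖z.2‖ ^ 2 ≤ 1 := not_lt.1 fun h => hz (shellSymbol_eq_zero hφ ht h)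
  simp only [Metric.mem_closedBall, dist_zero_right]
  constructor <;> nlinarith [sq_nonneg ‖z.1‖, sq_nonneg ‖z.2‖]

theorem support_shellSymbol_subset {φ : 𝓢(ℝ, ℂ)} (hφ : ∀ u ∉ Set.Icc (1 / 2 : ℝ) 2, φ u = 0)
    {t : ℝ} (ht : 0 ≤ t) :
    tsupport (shellSymbol φ t : V × V → ℂ) ⊆ Metric.closedBall 0 1 := by
  refine closure_minimal (fun z hz => ?_) Metric.isClosed_closedBall
  have h : ‖z.1‖ ^ 2 + ‖z.2‖ ^ 2 ≤ 1 := not_lt.1 fun h => hz (shellSymbol_eq_zero hφ ht h)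
  simp only [Metric.mem_closedBall, dist_zero_right, Prod.norm_def, max_le_iff]
  constructor <;> nlinarith [sq_nonneg ‖z.1‖, sq_nonneg ‖z.2‖]

/-- Fourier inversion of `φ`: the phase is a sum of a function of `ξ` and a function of `η`, the
form needed for the `L² × L² → L¹` bound. The amplitude has the modulus of `𝓕 φ`, so its `L¹` norm
does not depend on `t`. -/
theorem shellSymbol_eq_integral (φ : 𝓢(ℝ, ℂ)) (t : ℝ) (z : V × V) :
    shellSymbol φ t z = ∫ τ, Real.fourierChar (τ * (-(t * ‖z.1‖ ^ 2) + -(t * ‖z.2‖ ^ 2))) •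
      (Real.fourierChar (t * τ) • 𝓕 φ τ) := by
  have h : (𝓕⁻ (𝓕 (φ : ℝ → ℂ))) (t * (1 - ‖z.1‖ ^ 2 - ‖z.2‖ ^ 2)) =
      φ (t * (1 - ‖z.1‖ ^ 2 - ‖z.2‖ ^ 2)) := by
    rw [φ.continuous.fourierInv_fourier_eq φ.integrable (by
      rw [← SchwartzMap.fourier_coe]; exact (𝓕 φ).integrable)]
  rw [shellSymbol, ← h, Real.fourierInv_eq]
  refine integral_congr_ae (.of_forall fun τ => ?_)
  simp only [smul_smul, ← AddChar.map_add_eq_mul, SchwartzMap.fourier_coe]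
  congr 2
  simp
  ring

end Symbol

/-! ### Volume of shell sections and `L² × L² → L^s` bounds. -/

section Shell

variable {V : Type*} [NormedAddCommGroup V] [InnerProductSpace ℝ V] [FiniteDimensional ℝ V]
  [MeasurableSpace V] [BorelSpace V]

theorem volume_spherical_shell_le (hn : 2 ≤ Module.finrank ℝ V) {s h : ℝ} (hh : 0 ≤ h)
    (hsh : s + h ≤ 1) :
    volume {u : V | s ≤ ‖u‖ ^ 2 ∧ ‖u‖ ^ 2 ≤ s + h} ≤
      ENNReal.ofReal ((Module.finrank ℝ V : ℝ) * h) * volume (Metric.ball (0 : V) 1) := by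
  have : Nontrivial V := Module.finrank_pos_iff (R := ℝ) |>.1 (by omega)
  by_cases h0 : s + h < 0
  · have : {u : V | s ≤ ‖u‖ ^ 2 ∧ ‖u‖ ^ 2 ≤ s + h} = ∅ := by
      ext u; simp only [Set.mem_ofPred_eq, Set.mem_empty_iff_false, iff_false]
      rintro ⟨-, h2⟩
      nlinarith [sq_nonneg ‖u‖]
    simp [this]
  push Not at h0
  -- The lower bound `s` may be negative, in which case the annulus is a full ball.
  set a := √(max s 0)
  set b := √(s + h)
  have ha : 0 ≤ a := Real.sqrt_nonneg _
  have hab : a ≤ b := Real.sqrt_le_sqrt (max_le (by linarith) h0)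
  have hb : b ≤ 1 := Real.sqrt_le_one.2 hsh
  have hsub : {u : V | s ≤ ‖u‖ ^ 2 ∧ ‖u‖ ^ 2 ≤ s + h} ⊆
      Metric.closedBall 0 b \ Metric.ball 0 a := by
    rintro u ⟨h1, h2⟩
    simp only [Set.mem_sdiff, Metric.mem_closedBall, dist_zero_right, Metric.mem_ball, not_lt]
    exact ⟨Real.le_sqrt_of_sq_le h2, Real.sqrt_le_iff.2 ⟨norm_nonneg _, max_le h1 (sq_nonneg _)⟩⟩
  refine (measure_mono hsub).trans ?_
  rw [measure_sdiff (Metric.ball_subset_closedBall.trans (Metric.closedBall_subset_closedBall hab))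
    measurableSet_ball.nullMeasurableSet measure_ball_lt_top.ne,
    Measure.addHaar_closedBall _ _ (ha.trans hab), Measure.addHaar_ball _ _ ha,
    ← ENNReal.sub_mul (fun _ _ => measure_ball_lt_top.ne),
    ← ENNReal.ofReal_sub _ (by positivity)]
  gcongr
  obtain ⟨k, hk⟩ := Nat.exists_eq_add_of_le' hn
  rw [hk]
  refine (pow_sub_pow_le_sq_sub_sq ha hab hb k).trans ?_
  rw [Real.sq_sqrt h0, Real.sq_sqrt (le_max_right _ _)]
  have := le_max_left s 0
  push_cast
  calc (k + 1 : ℝ) * (s + h - max s 0) ≤ (k + 1) * h := by gcongr; linarith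
    _ ≤ (k + 2) * h := by gcongr; norm_num

/-- Since `|ξ|² + |ζ-ξ|² = 2|ξ-ζ/2|² + |ζ|²/2`, the section of the shell is an annulus centred at
`ζ/2`, of volume `O(1/t)` uniformly in `ζ`. -/
theorem shellSymbol_section_sq_le (hn : 2 ≤ Module.finrank ℝ V) {φ : 𝓢(ℝ, ℂ)}
    (hφ : ∀ u ∉ Set.Icc (1 / 2 : ℝ) 2, φ u = 0) :
    ∃ K : ℝ≥0∞, K ≠ ⊤ ∧ ∀ t : ℝ, 1 ≤ t → ∀ ζ : V,
      ∫⁻ ξ, ‖shellSymbol φ t (ξ, ζ - ξ)‖ₑ ^ (2 : ℝ) ≤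
        (K * ENNReal.ofReal t ^ (-(1 / 2) : ℝ)) ^ (2 : ℝ) := by
  obtain ⟨M, hM0, hM⟩ := exists_norm_shellSymbol_le (V := V) φ
  set n := Module.finrank ℝ V
  set A : ℝ≥0∞ := ENNReal.ofReal M ^ (2 : ℝ) *
    (ENNReal.ofReal (n * (3 / 4)) * volume (Metric.ball (0 : V) 1)) with hA
  have hAt : A ≠ ⊤ := ENNReal.mul_ne_top (by simp)
    (ENNReal.mul_ne_top ENNReal.ofReal_ne_top measure_ball_lt_top.ne)
  refine ⟨A ^ (1 / 2 : ℝ), ENNReal.rpow_ne_top_of_nonneg (by norm_num) hAt, fun t ht ζ => ?_⟩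
  have ht0 : 0 < t := by linarith
  rw [ENNReal.mul_rpow_of_nonneg _ _ (by norm_num), ← ENNReal.rpow_mul, ← ENNReal.rpow_mul]
  norm_num
  rw [ENNReal.rpow_neg_one]
  -- The support condition puts `2|u|²` in an interval of length `(2 - 1/2)/t`, hence the width
  -- `3/(4t)` for `|u|²`.
  set S : Set V := {u | (1 - ‖ζ‖ ^ 2 / 2 - 2 / t) / 2 ≤ ‖u‖ ^ 2 ∧
    ‖u‖ ^ 2 ≤ (1 - ‖ζ‖ ^ 2 / 2 - 2 / t) / 2 + 3 / 4 * t⁻¹} with hS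
  have hSm : MeasurableSet S := by
    rw [hS, Set.ofPred_and]
    exact (measurableSet_le measurable_const (by fun_prop)).inter
      (measurableSet_le (by fun_prop) measurable_const)
  have hpt : ∀ ξ, ‖shellSymbol φ t (ξ, ζ - ξ)‖ₑ ^ 2 ≤
      S.indicator (fun _ => ENNReal.ofReal M ^ 2) (ξ - (1 / 2 : ℝ) • ζ) := fun ξ => by
    by_cases hξ : ξ - (1 / 2 : ℝ) • ζ ∈ S
    · rw [Set.indicator_of_mem hξ, ← ofReal_norm]
      gcongr
      exact hM _ _
    · rw [Set.indicator_of_notMem hξ, shellSymbol, hφ]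
      · simp
      contrapose! hξ
      have e1 : ‖ξ - (1 / 2 : ℝ) • ζ‖ ^ 2 = ‖ξ‖ ^ 2 - ⟪ξ, ζ⟫ + ‖ζ‖ ^ 2 / 4 := by
        rw [norm_sub_sq_real, inner_smul_right, norm_smul]; norm_num; ring
      have e2 : ‖ζ - ξ‖ ^ 2 = ‖ζ‖ ^ 2 - 2 * ⟪ξ, ζ⟫ + ‖ξ‖ ^ 2 := by
        rw [norm_sub_sq_real, real_inner_comm]
      obtain ⟨h1, h2⟩ := hξ
      simp only [e2] at h1 h2
      rw [← div_le_iff₀' ht0] at h1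
      rw [← le_div_iff₀' ht0] at h2
      have h3 : 2 / t = 2 * t⁻¹ := by ring
      have h4 : 1 / 2 / t = 1 / 2 * t⁻¹ := by ring
      rw [h4] at h1
      rw [h3] at h2
      simp only [hS, Set.mem_ofPred_eq, e1, h3]
      constructor <;> linarith
  have hti : 0 < t⁻¹ := by positivity
  calc ∫⁻ ξ, ‖shellSymbol φ t (ξ, ζ - ξ)‖ₑ ^ 2
      ≤ ∫⁻ ξ, S.indicator (fun _ => ENNReal.ofReal M ^ 2) (ξ - (1 / 2 : ℝ) • ζ) :=
        lintegral_mono hpt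
    _ = ENNReal.ofReal M ^ 2 * volume S := by
        rw [lintegral_sub_right_eq_self (S.indicator fun _ => ENNReal.ofReal M ^ 2),
          lintegral_indicator_const hSm]
    _ ≤ ENNReal.ofReal M ^ 2 * (ENNReal.ofReal (n * (3 / 4 * t⁻¹)) *
          volume (Metric.ball (0 : V) 1)) := by
        gcongr
        refine volume_spherical_shell_le hn (by positivity) ?_
        have h3 : 2 / t = 2 * t⁻¹ := by ring
        rw [h3]
        nlinarith [sq_nonneg ‖ζ‖]
    _ = A * (ENNReal.ofReal t)⁻¹ := by
        rw [hA, ← ENNReal.ofReal_inv_of_pos ht0, ← mul_assoc (n : ℝ),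
          ENNReal.ofReal_mul (by positivity)]
        simp only [ENNReal.rpow_two]
        ring

/-- The exponent gained from the thickness of the shell. -/
noncomputable def shellGain (s : ℝ) : ℝ := min (1 / 2) (1 - 1 / s)

/-- `L² × L² → L^s` bounds for the bilinear multiplier with symbol supported in a thin shell. -/
theorem exists_eLpNorm'_shell_le (hn : 2 ≤ Module.finrank ℝ V) {φ : 𝓢(ℝ, ℂ)}
    (hφ : ∀ u ∉ Set.Icc (1 / 2 : ℝ) 2, φ u = 0) {s : ℝ} (hs : 1 ≤ s) :
    ∃ C : ℝ≥0∞, C ≠ ⊤ ∧ ∀ t : ℝ, 1 ≤ t → ∀ U W : V → ℂ, Integrable U → Integrable W →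
      MemLp U 2 → MemLp W 2 → eLpNorm' (bilinearMultiplier (shellSymbol φ t) U W) s volume ≤
        C * ENNReal.ofReal t ^ (-shellGain s) *
          (eLpNorm' U 2 volume * eLpNorm' W 2 volume) := by
  obtain ⟨M, hM0, hM⟩ := exists_norm_shellSymbol_le (V := V) φ
  obtain ⟨K, hK, hKb⟩ := shellSymbol_section_sq_le hn hφ
  have hs0 : 0 < s := by linarith
  -- Radius 2 suffices, as both frequencies lie in the unit ball.
  set B : Set V := Metric.closedBall 0 2
  have hBt : volume B ≠ ⊤ := measure_closedBall_lt_top.ne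
  have hL2 : ∀ s : ℝ, 2 ≤ s → ∀ t : ℝ, 1 ≤ t → ∀ U W : V → ℂ, Integrable U → Integrable W →
      MemLp U 2 → MemLp W 2 → eLpNorm' (bilinearMultiplier (shellSymbol φ t) U W) s volume ≤
        volume B ^ (1 / 2 - 1 / s) * (K * ENNReal.ofReal t ^ (-(1 / 2) : ℝ) *
          (eLpNorm' U 2 volume * eLpNorm' W 2 volume)) := by
    intro s hs t ht U W hU hW hU2 hW2
    have ht0 : 0 < t := by linarith
    refine eLpNorm'_bilinearMultiplier_le_of_two_le (continuous_shellSymbol φ t) (hM t) hU hW hU2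
      hW2 (ENNReal.mul_ne_top hK (ENNReal.rpow_ne_top_of_ne_zero (by simpa using ht0) (by simp)))
      (hKb t ht) measurableSet_closedBall (fun z hz => ?_) hs
    refine shellSymbol_eq_zero hφ (by linarith) ?_
    simp only [Metric.mem_closedBall, dist_zero_right, not_le] at hz
    have := norm_add_le z.1 z.2
    nlinarith [norm_nonneg z.1, norm_nonneg z.2, sq_nonneg (‖z.1‖ - ‖z.2‖)]
  rcases le_total s 2 with hs2 | hs2
  · have hgain : shellGain s = 1 - 1 / s := min_eq_right (by
      have : 1 / 2 ≤ 1 / s := one_div_le_one_div_of_le hs0 hs2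
      linarith)
    have e1 : 0 ≤ 2 / s - 1 := by rw [sub_nonneg, le_div_iff₀ hs0]; linarith
    have e2 : 0 ≤ 2 - 2 / s := by rw [sub_nonneg, div_le_iff₀ hs0]; linarith
    set k := ∫⁻ τ, ‖𝓕 φ τ‖ₑ
    have hk : k ≠ ⊤ := (𝓕 φ).integrable.2.ne
    refine ⟨k ^ (2 / s - 1) * K ^ (2 - 2 / s), ENNReal.mul_ne_top
      (ENNReal.rpow_ne_top_of_nonneg e1 hk) (ENNReal.rpow_ne_top_of_nonneg e2 hK), ?_⟩
    intro t ht U W hU hW hU2 hW2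
    have hTm : AEStronglyMeasurable (bilinearMultiplier (shellSymbol φ t) U W) volume := by
      rw [bilinearMultiplier_eq_fourierInv (continuous_shellSymbol φ t) (hM t) hU hW]
      have hc := continuous_fourier
        (integrable_twistedConv (continuous_shellSymbol φ t) (hM t) hU hW)
      have : 𝓕⁻ (twistedConv (shellSymbol φ t) U W) =
          fun x => 𝓕 (twistedConv (shellSymbol φ t) U W) (-x) := by
        ext x; rw [Real.fourierInv_eq_fourier_neg]
      rw [this]
      exact (hc.comp continuous_neg).aestronglyMeasurable
    -- No power of `t` is gained in `L¹`; the gain comes from the `L²` bound raised to the power `2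
    -- - 2/s`, which gives `t^(-(1 - 1/s))`.
    have h1 := eLpNorm'_one_bilinearMultiplier_le (m := shellSymbol φ t) (U := U) (W := W)
      (k := fun τ => Real.fourierChar (t * τ) • 𝓕 φ τ) (a := fun ξ => -(t * ‖ξ‖ ^ 2))
      (integrable_fourierChar_smul (by fun_prop) (𝓕 φ).integrable) (by fun_prop)
      (shellSymbol_eq_integral φ t) hU hW hU2 hW2
    simp_rw [enorm_circle_smul] at h1
    have h2 := hL2 2 le_rfl t ht U W hU hW hU2 hW2
    rw [sub_self, ENNReal.rpow_zero, one_mul] at h2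
    set N := eLpNorm' U 2 volume * eLpNorm' W 2 volume
    refine (eLpNorm'_le_interpolate_one_two hTm hs hs2).trans ?_
    refine (mul_le_mul' (ENNReal.rpow_le_rpow h1 e1) (ENNReal.rpow_le_rpow h2 e2)).trans_eq ?_
    rw [ENNReal.mul_rpow_of_nonneg _ _ e1, ENNReal.mul_rpow_of_nonneg _ _ e2,
      ENNReal.mul_rpow_of_nonneg _ _ e2, ← ENNReal.rpow_mul, hgain,
      show -(1 / 2) * (2 - 2 / s) = -(1 - 1 / s) by ring]
    have hN : N ^ (2 / s - 1) * N ^ (2 - 2 / s) = N := by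
      rw [← ENNReal.rpow_add_of_nonneg _ _ e1 e2, show 2 / s - 1 + (2 - 2 / s) = 1 by ring,
        ENNReal.rpow_one]
    calc _ = k ^ (2 / s - 1) * K ^ (2 - 2 / s) * ENNReal.ofReal t ^ (-(1 - 1 / s)) *
          (N ^ (2 / s - 1) * N ^ (2 - 2 / s)) := by ring
      _ = _ := by rw [hN]
  · have hgain : shellGain s = 1 / 2 := min_eq_left (by
      have : 1 / s ≤ 1 / 2 := one_div_le_one_div_of_le (by norm_num) hs2
      linarith)
    refine ⟨volume B ^ (1 / 2 - 1 / s) * K, ENNReal.mul_ne_top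
      (ENNReal.rpow_ne_top_of_nonneg ?_ hBt) hK, fun t ht U W hU hW hU2 hW2 => ?_⟩
    · have : 1 / s ≤ 1 / 2 := one_div_le_one_div_of_le (by norm_num) hs2
      linarith
    · refine (hL2 s hs2 t ht U W hU hW hU2 hW2).trans_eq ?_
      rw [hgain]
      ring

end Shell

/-! ### Shell operators on functions supported in a ball. -/

section Localized

theorem eLpNorm'_restrict_of_support {α : Type*} [MeasurableSpace α] {μ : Measure α} {u : α → ℂ}
    {S : Set α} (hS : MeasurableSet S) (hu : ∀ x ∉ S, u x = 0) {s : ℝ} (hs : 0 < s) :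
    eLpNorm' u s (μ.restrict S) = eLpNorm' u s μ := by
  rw [eLpNorm', eLpNorm', ← lintegral_indicator hS]
  congr 2; ext x
  by_cases hx : x ∈ S
  · simp [hx]
  · simp [hx, hu, ENNReal.zero_rpow_of_pos hs]

variable {V : Type*} [NormedAddCommGroup V] [InnerProductSpace ℝ V]

variable (V) in
/-- The exponent lost in passing from `L^p` to `L²` on a ball. -/
noncomputable def ballLoss (p : ℝ) : ℝ := Module.finrank ℝ V * max 0 (1 / 2 - 1 / p)

variable (V) in
theorem ballLoss_nonneg (p : ℝ) : 0 ≤ ballLoss V p :=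
  mul_nonneg (Nat.cast_nonneg _) (le_max_left _ _)

variable [FiniteDimensional ℝ V] [MeasurableSpace V] [BorelSpace V]

/-- For `p ≤ 2` the restriction estimate for the unit ball costs nothing. For `p ≥ 2` one applies
Plancherel and then Hölder on the ball of radius `ρ`, whose volume produces the loss. -/
theorem exists_eLpNorm'_indicator_fourier_le {p : ℝ} (hp : 1 < p) :
    ∃ C : ℝ≥0∞, C ≠ ⊤ ∧ ∀ ρ : ℝ, 1 ≤ ρ → ∀ (a : V) (u : V → ℂ), Integrable u → MemLp u 2 →
      (∀ x ∉ Metric.ball a ρ, u x = 0) →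
      eLpNorm' ((Metric.closedBall (0 : V) 1).indicator (𝓕 u)) 2 volume ≤
        C * ENNReal.ofReal ρ ^ ballLoss V p * eLpNorm' u p volume := by
  have hp0 : 0 < p := by linarith
  rcases le_total p 2 with hp2 | hp2
  · have hpp := Real.HolderConjugate.conjExponent hp
    refine ⟨volume (Metric.closedBall (0 : V) 1) ^ (1 / 2 - 1 / p.conjExponent),
      ENNReal.rpow_ne_top_of_ne_zero (Metric.measure_closedBall_pos _ _ one_pos).ne'
        measure_closedBall_lt_top.ne, fun ρ hρ a u hu hu2 hs => ?_⟩
    refine (eLpNorm'_indicator_fourier_le hpp hp2 measurableSet_closedBall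
      measure_closedBall_lt_top.ne hu).trans ?_
    gcongr
    refine le_mul_of_one_le_right' ?_
    simpa using ENNReal.rpow_le_rpow (ENNReal.one_le_ofReal.2 hρ) (ballLoss_nonneg V p)
  · have hmax : max 0 (1 / 2 - 1 / p) = 1 / 2 - 1 / p := max_eq_right (by
      have : 1 / p ≤ 1 / 2 := one_div_le_one_div_of_le (by norm_num) hp2
      linarith)
    refine ⟨volume (Metric.ball (0 : V) 1) ^ (1 / 2 - 1 / p),
      ENNReal.rpow_ne_top_of_ne_zero (Metric.measure_ball_pos _ _ one_pos).ne'
        measure_ball_lt_top.ne, fun ρ hρ a u hu hu2 hs => ?_⟩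
    have h1 : eLpNorm' ((Metric.closedBall (0 : V) 1).indicator (𝓕 u)) 2 volume ≤
        eLpNorm' u 2 volume := by
      rw [eLpNorm', eLpNorm', ← lintegral_enorm_fourier_sq hu hu2]
      gcongr
      exact enorm_indicator_le_enorm_self _ _
    refine h1.trans ?_
    rw [← eLpNorm'_restrict_of_support measurableSet_ball hs two_pos,
      ← eLpNorm'_restrict_of_support measurableSet_ball hs hp0]
    refine (eLpNorm'_le_eLpNorm'_mul_rpow_measure_univ two_pos hp2 hu.1.restrict).trans_eq ?_
    rw [Measure.restrict_apply_univ, Measure.addHaar_ball_of_pos _ _ (by linarith),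
      ENNReal.mul_rpow_of_ne_top ENNReal.ofReal_ne_top measure_ball_lt_top.ne, ballLoss, hmax,
      ENNReal.ofReal_pow (by linarith), ← ENNReal.rpow_natCast, ← ENNReal.rpow_mul]
    ring

theorem bilinearMultiplier_congr {m : V × V → ℂ} {U W U' W' : V → ℂ} {B : Set V}
    (hm : ∀ z : V × V, m z ≠ 0 → z.1 ∈ B ∧ z.2 ∈ B) (hU : ∀ x ∈ B, U x = U' x)
    (hW : ∀ x ∈ B, W x = W' x) : bilinearMultiplier m U W = bilinearMultiplier m U' W' := by
  ext x
  refine integral_congr_ae (.of_forall fun z => ?_)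
  by_cases h : m z = 0
  · simp [h]
  · simp [hU _ (hm z h).1, hW _ (hm z h).2]

/-- The bilinear operator with symbol `φ(t(1 - |ξ|² - |η|²))`. -/
noncomputable def shellOperator (φ : 𝓢(ℝ, ℂ)) (t : ℝ) (f g : V → ℂ) : V → ℂ :=
  bilinearMultiplier (shellSymbol φ t) (𝓕 f) (𝓕 g)

theorem exists_eLpNorm'_shellOperator_le (hn : 2 ≤ Module.finrank ℝ V) {φ : 𝓢(ℝ, ℂ)}
    (hφ : ∀ u ∉ Set.Icc (1 / 2 : ℝ) 2, φ u = 0) {p q r : ℝ} (hp : 1 < p) (hq : 1 < q)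
    (hr : 1 ≤ r) :
    ∃ C : ℝ≥0∞, C ≠ ⊤ ∧ ∀ t : ℝ, 1 ≤ t → ∀ ρ : ℝ, 1 ≤ ρ → ∀ (a : V) (u v : V → ℂ),
      Integrable u → Integrable v → MemLp u 2 → MemLp v 2 →
      (∀ x ∉ Metric.ball a ρ, u x = 0) → (∀ x ∉ Metric.ball a ρ, v x = 0) →
      eLpNorm' (shellOperator φ t u v) r volume ≤
        C * (ENNReal.ofReal t ^ (-shellGain r) * ENNReal.ofReal ρ ^ (ballLoss V p + ballLoss V q)) *
          (eLpNorm' u p volume * eLpNorm' v q volume) := by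
  obtain ⟨C, hC, hCb⟩ := exists_eLpNorm'_shell_le hn hφ hr
  obtain ⟨C₁, hC₁, hCb₁⟩ := exists_eLpNorm'_indicator_fourier_le (V := V) hp
  obtain ⟨C₂, hC₂, hCb₂⟩ := exists_eLpNorm'_indicator_fourier_le (V := V) hq
  refine ⟨C * (C₁ * C₂), ENNReal.mul_ne_top hC (ENNReal.mul_ne_top hC₁ hC₂), ?_⟩
  intro t ht ρ hρ a u v hu hv hu2 hv2 hus hvs
  set B : Set V := Metric.closedBall 0 1 with hB
  have hBm : MeasurableSet B := measurableSet_closedBall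
  have hind : ∀ {u : V → ℂ}, Integrable u → ∀ s : ℝ≥0∞, MemLp (B.indicator (𝓕 u)) s := by
    intro u hu s
    have h1 : MemLp (B.indicator fun _ => (∫⁻ y, ‖u y‖ₑ).toReal) s volume :=
      memLp_indicator_const s hBm _ (Or.inr measure_closedBall_lt_top.ne)
    refine h1.mono ((continuous_fourier hu).aestronglyMeasurable.indicator hBm)
      (.of_forall fun x => ?_)
    by_cases hx : x ∈ B
    · simp only [Set.indicator_of_mem hx]
      refine le_trans ?_ (le_abs_self _)
      rw [← toReal_enorm]
      exact ENNReal.toReal_mono hu.2.ne (enorm_fourier_le u x)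
    · simp [hx]
  -- Truncating both transforms to the unit ball is harmless because the symbol vanishes unless both
  -- frequencies lie there.
  have hT : shellOperator φ t u v =
      bilinearMultiplier (shellSymbol φ t) (B.indicator (𝓕 u)) (B.indicator (𝓕 v)) :=
    bilinearMultiplier_congr (B := B) (fun z => shellSymbol_ne_zero hφ (by linarith))
      (fun x hx => by simp [hx]) (fun x hx => by simp [hx])
  rw [hT]
  refine (hCb t ht _ _ (memLp_one_iff_integrable.1 (hind hu 1))
    (memLp_one_iff_integrable.1 (hind hv 1)) (hind hu 2) (hind hv 2)).trans ?_
  refine (mul_le_mul_right (mul_le_mul' (hCb₁ ρ hρ a u hu hu2 hus) (hCb₂ ρ hρ a v hv hv2 hvs))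
    _).trans_eq ?_
  rw [ENNReal.rpow_add _ _ (by simp; linarith) ENNReal.ofReal_ne_top]
  ring

end Localized

/-! ### Decay of the convolution kernel. -/

section Kernel

variable {V : Type*} [NormedAddCommGroup V] [InnerProductSpace ℝ V]

variable (V) in
/-- The Euclidean inner product on `V × V`. -/
noncomputable def prodInner : V × V →L[ℝ] V × V →L[ℝ] ℝ :=
  (innerSL ℝ).bilinearComp (.fst ℝ V V) (.fst ℝ V V) +
    (innerSL ℝ).bilinearComp (.snd ℝ V V) (.snd ℝ V V)

theorem prodInner_apply (v w : V × V) : prodInner V v w = ⟪v.1, w.1⟫ + ⟪v.2, w.2⟫ := rfl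

/-- `V × V` carries the sup norm, so a unit vector along the larger component suffices.
Differentiating the symbol in this direction produces a full factor `‖w‖`. -/
theorem exists_prodInner_eq_norm (w : V × V) : ∃ v, ‖v‖ ≤ 1 ∧ |prodInner V v w| = ‖w‖ := by
  have h1 : ∀ x : V, ‖‖x‖⁻¹ • x‖ ≤ 1 := fun x => by
    rw [norm_smul, norm_inv, norm_norm]; exact inv_mul_le_one
  have h2 : ∀ x : V, ⟪‖x‖⁻¹ • x, x⟫ = ‖x‖ := fun x => by
    rw [real_inner_smul_left, real_inner_self_eq_norm_sq]
    by_cases h : ‖x‖ = 0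
    · simp [h]
    · field_simp
  rcases le_total ‖w.1‖ ‖w.2‖ with h | h
  · refine ⟨(0, ‖w.2‖⁻¹ • w.2), by simpa [Prod.norm_def] using h1 w.2, ?_⟩
    rw [prodInner_apply, h2, Prod.norm_def, max_eq_right h]; simp
  · refine ⟨(‖w.1‖⁻¹ • w.1, 0), by simpa [Prod.norm_def] using h1 w.1, ?_⟩
    rw [prodInner_apply, h2, Prod.norm_def, max_eq_left h]; simp

theorem contDiff_shellSymbol (φ : 𝓢(ℝ, ℂ)) (t : ℝ) (N : ℕ∞) :
    ContDiff ℝ N (shellSymbol φ t : V × V → ℂ) :=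
  (φ.smooth N).comp (contDiff_const.mul ((contDiff_const.sub (contDiff_fst.norm_sq ℝ)).sub
    (contDiff_snd.norm_sq ℝ)))

variable [FiniteDimensional ℝ V]

/-- Chain rule for `φ` composed with `t` times a fixed quadratic polynomial: each derivative costs
at most a factor `O(t)`, and the support stays in the unit ball. -/
theorem exists_norm_iteratedFDeriv_shellSymbol_le {φ : 𝓢(ℝ, ℂ)}
    (hφ : ∀ u ∉ Set.Icc (1 / 2 : ℝ) 2, φ u = 0) (N : ℕ) :
    ∃ C : ℝ, 0 ≤ C ∧ ∀ t : ℝ, 1 ≤ t → ∀ i ≤ N, ∀ z : V × V,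
      ‖iteratedFDeriv ℝ i (shellSymbol φ t) z‖ ≤
        (Metric.closedBall (0 : V × V) 1).indicator (fun _ => C * t ^ N) z := by
  set h : V × V → ℝ := fun z => 1 - ‖z.1‖ ^ 2 - ‖z.2‖ ^ 2 with hh
  have hcd : ∀ M : ℕ∞, ContDiff ℝ M h := fun M =>
    (contDiff_const.sub (contDiff_fst.norm_sq ℝ)).sub (contDiff_snd.norm_sq ℝ)
  have hbd : ∀ i : ℕ, ∃ A : ℝ, ∀ z ∈ Metric.closedBall (0 : V × V) 1,
      ‖iteratedFDeriv ℝ i h z‖ ≤ A := fun i =>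
    (isCompact_closedBall _ _).exists_bound_of_continuousOn
      ((hcd i).continuous_iteratedFDeriv le_rfl).continuousOn
  choose A hA using hbd
  set A' : ℝ := 1 + ∑ i ∈ Finset.range (N + 1), |A i|
  have hA'1 : 1 ≤ A' := le_add_of_nonneg_right (Finset.sum_nonneg fun _ _ => abs_nonneg _)
  have hA' : ∀ i ≤ N, A i ≤ A' := fun i hi => (le_abs_self _).trans
    ((Finset.single_le_sum (f := fun i => |A i|) (fun _ _ => abs_nonneg _)
      (Finset.mem_range.2 (by omega))).trans (le_add_of_nonneg_left zero_le_one))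
  set S : ℝ := ∑ i ∈ Finset.range (N + 1), SchwartzMap.seminorm ℝ 0 i φ
  have hS0 : 0 ≤ S := Finset.sum_nonneg fun _ _ => apply_nonneg _ _
  have hS : ∀ i ≤ N, ∀ u, ‖iteratedFDeriv ℝ i φ u‖ ≤ S := fun i hi u => by
    refine le_trans ?_ (Finset.single_le_sum
      (f := fun i => SchwartzMap.seminorm ℝ 0 i φ) (fun _ _ => apply_nonneg _ _)
      (Finset.mem_range.2 (Nat.lt_succ_of_le hi)))
    simpa using SchwartzMap.le_seminorm ℝ 0 i φ u
  refine ⟨N.factorial * S * A' ^ N, by positivity, fun t ht i hi z => ?_⟩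
  have ht0 : 0 ≤ t := by linarith
  by_cases hz : z ∈ Metric.closedBall (0 : V × V) 1
  · rw [Set.indicator_of_mem hz]
    -- Every derivative of the inner function is only linear in `t`; it is dominated by the `j`-th
    -- power because `t * A' ≥ 1`, which is why `A'` starts with a 1.
    have hD : ∀ j, 1 ≤ j → j ≤ i → ‖iteratedFDeriv ℝ j (fun z => t * h z) z‖ ≤ (t * A') ^ j := by
      intro j hj1 hji
      have e : (fun z => t * h z) = t • h := rfl
      rw [e, iteratedFDeriv_const_smul_apply (hcd j).contDiffAt, norm_smul, Real.norm_of_nonneg ht0]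
      calc t * ‖iteratedFDeriv ℝ j h z‖ ≤ t * A' := by
            gcongr; exact (hA j z hz).trans (hA' j (hji.trans hi))
        _ ≤ (t * A') ^ j := le_self_pow₀ (by nlinarith) (by omega)
    have := norm_iteratedFDeriv_comp_le (𝕜 := ℝ) (g := φ) (f := fun z => t * h z) (n := i)
      (N := (i : ℕ∞)) (φ.smooth i) (contDiff_const.mul (hcd i)) le_rfl z
      (C := S) (D := t * A') (fun j hj => hS j (hj.trans hi) _) hD
    refine this.trans ?_
    have hf : (i.factorial : ℝ) ≤ N.factorial := by exact_mod_cast Nat.factorial_le hi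
    calc (i.factorial : ℝ) * S * (t * A') ^ i ≤ N.factorial * S * (t * A') ^ N := by
          gcongr
          nlinarith
      _ = _ := by rw [mul_pow, mul_assoc, mul_assoc, mul_assoc, mul_comm (t ^ N)]
  · rw [Set.indicator_of_notMem hz]
    have : z ∉ Function.support (iteratedFDeriv ℝ i (shellSymbol φ t : V × V → ℂ)) := fun hs =>
      hz (support_shellSymbol_subset hφ ht0 (support_iteratedFDeriv_subset i hs))
    simp only [Function.mem_support, not_not] at this
    simp [this]

variable [MeasurableSpace V] [BorelSpace V]

instance : (volume : Measure (V × V)).IsAddHaarMeasure :=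
  inferInstanceAs (Measure.IsAddHaarMeasure ((volume : Measure V).prod (volume : Measure V)))

/-- The convolution kernel of `shellOperator`. -/
noncomputable def shellKernel (φ : 𝓢(ℝ, ℂ)) (t : ℝ) (w : V × V) : ℂ :=
  ∫ z : V × V, Real.fourierChar (⟪w.1, z.1⟫ + ⟪w.2, z.2⟫) • shellSymbol φ t z

/-- Integration by parts `N` times, against derivatives of size `t^N` on a fixed ball. -/
theorem exists_norm_shellKernel_le {φ : 𝓢(ℝ, ℂ)}
    (hφ : ∀ u ∉ Set.Icc (1 / 2 : ℝ) 2, φ u = 0) (N : ℕ) :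
    ∃ C : ℝ, 0 ≤ C ∧ ∀ t : ℝ, 1 ≤ t → ∀ w : V × V,
      ‖w‖ ^ N * ‖shellKernel φ t w‖ ≤ C * t ^ N := by
  obtain ⟨C, hC, hCb⟩ := exists_norm_iteratedFDeriv_shellSymbol_le (V := V) hφ N
  set B := Metric.closedBall (0 : V × V) 1
  refine ⟨2 ^ N * ((N + 1) * (C * (volume : Measure (V × V)).real B)), by positivity,
    fun t ht w => ?_⟩
  have hBi : Integrable (B.indicator fun _ => C * t ^ N) (volume : Measure (V × V)) :=
    (integrable_indicator_iff measurableSet_closedBall).2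
      (integrableOn_const measure_closedBall_lt_top.ne)
  have hint : ∀ i ≤ N, Integrable (fun z => ‖iteratedFDeriv ℝ i (shellSymbol φ t) z‖)
      (volume : Measure (V × V)) := fun i hi =>
    hBi.mono' ((contDiff_shellSymbol φ t i).continuous_iteratedFDeriv
      le_rfl).norm.aestronglyMeasurable (.of_forall fun z => by simpa using hCb t ht i hi z)
  have hle : ∀ i ≤ N, ∫ z, ‖iteratedFDeriv ℝ i (shellSymbol φ t) z‖ ∂(volume : Measure (V × V)) ≤
      C * (volume : Measure (V × V)).real B * t ^ N := fun i hi => by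
    refine (integral_mono (hint i hi) hBi (hCb t ht i hi)).trans_eq ?_
    rw [integral_indicator measurableSet_closedBall, setIntegral_const]
    simp only [smul_eq_mul]; ring
  obtain ⟨v, hv, hvw⟩ := exists_prodInner_eq_norm (-w)
  have hK : shellKernel φ t w =
      VectorFourier.fourierIntegral Real.fourierChar volume (prodInner V).toLinearMap₁₂
        (shellSymbol φ t) (-w) := by
    refine integral_congr_ae (.of_forall fun z => ?_)
    simp [prodInner_apply, real_inner_comm, add_comm]
  have := VectorFourier.pow_mul_norm_iteratedFDeriv_fourierIntegral_le (prodInner V)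
    (μ := (volume : Measure (V × V))) (f := shellSymbol φ t) (K := 0) (N := (N : ℕ∞))
    (contDiff_shellSymbol φ t N) (fun k i hk hi => by
      obtain rfl : k = 0 := by simpa using hk
      simpa using hint i (by exact_mod_cast hi)) (k := 0) (n := N) le_rfl le_rfl v (-w)
  rw [hvw, norm_iteratedFDeriv_zero, ← hK, norm_neg] at this
  refine this.trans ?_
  have hsum : ∑ p ∈ Finset.range (0 + 1) ×ˢ Finset.range (N + 1),
      ∫ z : V × V, ‖z‖ ^ p.1 * ‖iteratedFDeriv ℝ p.2 (shellSymbol φ t) z‖ ≤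
      (N + 1) * (C * (volume : Measure (V × V)).real B * t ^ N) := by
    refine (Finset.sum_le_card_nsmul _ _ (C * (volume : Measure (V × V)).real B * t ^ N)
      fun p hp => ?_).trans_eq ?_
    · simp only [Finset.mem_product, Finset.mem_range] at hp
      have h0 : p.1 = 0 := by omega
      simp only [h0, pow_zero, one_mul]
      exact hle p.2 (by omega)
    · simp
  rw [pow_zero, mul_one]
  calc _ ≤ 1 ^ N * (2 * ((0 : ℕ) : ℝ) + 2) ^ N *
        ((N + 1) * (C * (volume : Measure (V × V)).real B * t ^ N)) := by
        gcongr
    _ = _ := by simp; ring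

/-- The kernel lives at scale `t` with decay of every order; beyond `t^(1+ε)`, decay of order about
`d/ε` absorbs all powers of `t`. -/
theorem exists_lintegral_shellKernel_tail_le {φ : 𝓢(ℝ, ℂ)}
    (hφ : ∀ u ∉ Set.Icc (1 / 2 : ℝ) 2, φ u = 0) {ε : ℝ} (hε : 0 < ε) :
    ∃ C : ℝ≥0∞, C ≠ ⊤ ∧ ∀ t : ℝ, 1 ≤ t →
      ∫⁻ w in (Metric.ball (0 : V × V) (t ^ (1 + ε)))ᶜ, ‖shellKernel φ t w‖ₑ ≤ C := by
  set d := Module.finrank ℝ (V × V) + 1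
  obtain ⟨k, hk⟩ := exists_nat_ge (d / ε)
  obtain ⟨C, hC, hCb⟩ := exists_norm_shellKernel_le (V := V) hφ (k + d)
  refine ⟨ENNReal.ofReal (C * 2 ^ d) * ∫⁻ w : V × V, ENNReal.ofReal ((1 + ‖w‖) ^ (-(d : ℝ))),
    ENNReal.mul_ne_top ENNReal.ofReal_ne_top
      (finite_integral_one_add_norm (by simp [d])).ne, fun t ht => ?_⟩
  have ht0 : 0 < t := by linarith
  rw [← lintegral_const_mul' _ _ ENNReal.ofReal_ne_top]
  refine (setLIntegral_mono' measurableSet_ball.compl fun w hw => ?_).trans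
    (setLIntegral_le_lintegral _ _)
  rw [← ENNReal.ofReal_mul (by positivity), ← ofReal_norm]
  refine ENNReal.ofReal_le_ofReal ?_
  simp only [Set.mem_compl_iff, Metric.mem_ball, dist_zero_right, not_lt] at hw
  have hR : 1 ≤ t ^ (1 + ε) := Real.one_le_rpow ht (by linarith)
  have hw1 : 1 ≤ ‖w‖ := hR.trans hw
  -- The choice `k ≥ d/ε` is exactly `k + d ≤ (1 + ε)k`. The remaining `d` powers of `‖w‖` give
  -- integrability, as `d` exceeds the dimension by one.
  have h1 : t ^ (k + d) ≤ ‖w‖ ^ k := by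
    calc (t ^ (k + d) : ℝ) = t ^ ((k : ℝ) + d) := by rw [← Nat.cast_add, Real.rpow_natCast]
      _ ≤ t ^ ((1 + ε) * k) := by
        refine Real.rpow_le_rpow_of_exponent_le ht ?_
        rw [div_le_iff₀ hε] at hk
        linarith
      _ = (t ^ (1 + ε)) ^ k := by rw [Real.rpow_mul ht0.le, Real.rpow_natCast]
      _ ≤ ‖w‖ ^ k := by gcongr
  have h2 : (1 + ‖w‖) ^ d ≤ 2 ^ d * ‖w‖ ^ d := by
    rw [← mul_pow]; gcongr; linarith
  have h3 : ‖w‖ ^ d * ‖shellKernel φ t w‖ ≤ C := by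
    have hpos : 0 < ‖w‖ ^ k := by positivity
    refine le_of_mul_le_mul_left ?_ hpos
    calc ‖w‖ ^ k * (‖w‖ ^ d * ‖shellKernel φ t w‖) = ‖w‖ ^ (k + d) * ‖shellKernel φ t w‖ := by ring
      _ ≤ C * t ^ (k + d) := hCb t ht w
      _ ≤ C * ‖w‖ ^ k := by gcongr
      _ = _ := by ring
  rw [Real.rpow_neg (by positivity), Real.rpow_natCast, ← div_eq_mul_inv,
    le_div_iff₀ (by positivity)]
  calc ‖shellKernel φ t w‖ * (1 + ‖w‖) ^ d ≤ ‖shellKernel φ t w‖ * (2 ^ d * ‖w‖ ^ d) := by gcongr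
    _ = ‖w‖ ^ d * ‖shellKernel φ t w‖ * 2 ^ d := by ring
    _ ≤ _ := by gcongr

theorem integrable_shellSymbol {φ : 𝓢(ℝ, ℂ)}
    (hφ : ∀ u ∉ Set.Icc (1 / 2 : ℝ) 2, φ u = 0) {t : ℝ} (ht : 0 ≤ t) :
    Integrable (shellSymbol φ t : V × V → ℂ) :=
  (continuous_shellSymbol φ t).integrable_of_hasCompactSupport
    ((isCompact_closedBall 0 1).of_isClosed_subset (isClosed_tsupport _)
      (support_shellSymbol_subset hφ ht))

theorem continuous_shellKernel {φ : 𝓢(ℝ, ℂ)}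
    (hφ : ∀ u ∉ Set.Icc (1 / 2 : ℝ) 2, φ u = 0) {t : ℝ} (ht : 0 ≤ t) :
    Continuous (shellKernel φ t : V × V → ℂ) := by
  have hi := integrable_shellSymbol (V := V) hφ ht
  refine continuous_of_dominated (bound := fun z => ‖shellSymbol φ t z‖) (fun w => ?_)
    (fun w => .of_forall fun z => by simp [Circle.norm_smul]) hi.norm (.of_forall fun z => ?_)
  · exact aestronglyMeasurable_fourierChar_smul (by fun_prop) hi.1
  · simp_rw [Circle.smul_def]
    exact (continuous_fourierChar_coe (by fun_prop)).smul continuous_const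

theorem shellOperator_eq_integral_kernel {φ : 𝓢(ℝ, ℂ)}
    (hφ : ∀ u ∉ Set.Icc (1 / 2 : ℝ) 2, φ u = 0) {t : ℝ} (ht : 0 ≤ t) {f g : V → ℂ}
    (hf : Integrable f) (hg : Integrable g) (x : V) :
    shellOperator φ t f g x = ∫ w : V × V, shellKernel φ t w * (f (x - w.1) * g (x - w.2)) := by
  have hm := integrable_shellSymbol (V := V) hφ ht
  have hfg : Integrable fun w : V × V => f (x - w.1) * g (x - w.2) :=
    (hf.comp_sub_left x).mul_prod (hg.comp_sub_left x)
  have hint : Integrable (fun y : (V × V) × (V × V) =>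
      Real.fourierChar (⟪y.1.1, y.2.1⟫ + ⟪y.1.2, y.2.2⟫) •
        ((f (x - y.1.1) * g (x - y.1.2)) * shellSymbol φ t y.2)) (volume.prod volume) :=
    integrable_fourierChar_smul (by fun_prop) (hfg.mul_prod hm)
  have hF : ∀ {f : V → ℂ} (ξ : V), Real.fourierChar ⟪x, ξ⟫ • 𝓕 f ξ =
      ∫ y, Real.fourierChar ⟪y, ξ⟫ • f (x - y) := fun {f} ξ => by
    rw [← integral_sub_left_eq_self _ _ x, Real.fourier_eq]
    simp only [Circle.smul_def, ← integral_smul, sub_sub_cancel]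
    simp only [← Circle.smul_def, smul_smul, ← AddChar.map_add_eq_mul, inner_sub_left]
    simp only [sub_eq_add_neg]
  calc shellOperator φ t f g x
      = ∫ z : V × V, ∫ w : V × V, Real.fourierChar (⟪w.1, z.1⟫ + ⟪w.2, z.2⟫) •
        ((f (x - w.1) * g (x - w.2)) * shellSymbol φ t z) := by
        refine integral_congr_ae (.of_forall fun z => ?_)
        have h := integral_prod_mul (μ := volume) (ν := volume)
          (fun y => Real.fourierChar ⟪y, z.1⟫ • f (x - y))
          (fun y => Real.fourierChar ⟪y, z.2⟫ • g (x - y))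
        rw [← hF, ← hF] at h
        simp only [inner_add_right, AddChar.map_add_eq_mul, Circle.smul_def, Circle.coe_mul,
          smul_eq_mul] at h ⊢
        calc _ = shellSymbol φ t z * ((Real.fourierChar ⟪x, z.1⟫ : ℂ) * 𝓕 f z.1 *
              ((Real.fourierChar ⟪x, z.2⟫ : ℂ) * 𝓕 g z.2)) := by ring
          _ = _ := by
            rw [← h, ← integral_const_mul]
            refine integral_congr_ae (.of_forall fun w => ?_)
            ring
    _ = ∫ w : V × V, ∫ z : V × V, Real.fourierChar (⟪w.1, z.1⟫ + ⟪w.2, z.2⟫) •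
        ((f (x - w.1) * g (x - w.2)) * shellSymbol φ t z) := (integral_integral_swap hint).symm
    _ = _ := by
        refine integral_congr_ae (.of_forall fun w => ?_)
        simp only [shellKernel]
        rw [← integral_mul_const]
        refine integral_congr_ae (.of_forall fun z => ?_)
        simp only [Circle.smul_def, smul_eq_mul]
        ring

end Kernel

/-! ### From local to global estimates by averaging over balls. -/

section Averaging

variable {V : Type*} [NormedAddCommGroup V] [InnerProductSpace ℝ V] [FiniteDimensional ℝ V]
  [MeasurableSpace V] [BorelSpace V]

theorem measurable_setLIntegral_ball {h : V → ℝ≥0∞} (hh : Measurable h) (R : ℝ) :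
    Measurable fun a => ∫⁻ x in Metric.ball a R, h x := by
  have hS : MeasurableSet {z : V × V | dist z.2 z.1 < R} :=
    (isOpen_lt (by fun_prop) continuous_const).measurableSet
  have := ((hh.comp measurable_snd).indicator hS).lintegral_prod_right' (ν := (volume : Measure V))
  convert this using 2 with a
  rw [← lintegral_indicator measurableSet_ball]
  rfl

/-- Integrating the local integrals over all balls of radius `R` recovers the full integral. -/
theorem lintegral_setLIntegral_ball {h : V → ℝ≥0∞} (hh : Measurable h) (R : ℝ) :
    ∫⁻ a, ∫⁻ x in Metric.ball a R, h x = volume (Metric.ball (0 : V) R) * ∫⁻ x, h x := by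
  have hS : MeasurableSet {z : V × V | dist z.2 z.1 < R} :=
    (isOpen_lt (by fun_prop) continuous_const).measurableSet
  have hm := (hh.comp measurable_snd).indicator hS
  calc ∫⁻ a, ∫⁻ x in Metric.ball a R, h x
      = ∫⁻ a, ∫⁻ x, {z : V × V | dist z.2 z.1 < R}.indicator (fun z => h z.2) (a, x) := by
        refine lintegral_congr fun a => ?_
        rw [← lintegral_indicator measurableSet_ball]
        rfl
    _ = ∫⁻ x, ∫⁻ a, {z : V × V | dist z.2 z.1 < R}.indicator (fun z => h z.2) (a, x) :=
        lintegral_lintegral_swap hm.aemeasurable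
    _ = ∫⁻ x, volume (Metric.ball (0 : V) R) * h x := by
        refine lintegral_congr fun x => ?_
        have : ∀ a, {z : V × V | dist z.2 z.1 < R}.indicator (fun z => h z.2) (a, x) =
            (Metric.ball x R).indicator (fun _ => h x) a := fun a => by
          simp only [Set.indicator, Set.mem_ofPred_eq, Metric.mem_ball, dist_comm]
        simp_rw [this]
        rw [lintegral_indicator_const measurableSet_ball, Measure.addHaar_ball_center, mul_comm]
    _ = _ := lintegral_const_mul _ hh

/-- Hölder's inequality for the `L^p` and `L^q` norms over all balls of radius `R`. -/
theorem lintegral_local_norms_le {p q r : ℝ} (hp : 0 < p) (hq : 0 < q) (hr : 0 < r)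
    (hpqr : 1 / r = 1 / p + 1 / q) {F G : V → ℝ≥0∞} (hF : Measurable F) (hG : Measurable G)
    (R : ℝ) :
    ∫⁻ a, ((∫⁻ x in Metric.ball a R, F x ^ p) ^ (1 / p) *
        (∫⁻ x in Metric.ball a R, G x ^ q) ^ (1 / q)) ^ r ≤
      volume (Metric.ball (0 : V) R) *
        ((∫⁻ x, F x ^ p) ^ (1 / p) * (∫⁻ x, G x ^ q) ^ (1 / q)) ^ r := by
  have hpq : r / p + r / q = 1 := by
    rw [div_eq_mul_one_div r p, div_eq_mul_one_div r q, ← mul_add, ← hpqr]; field_simp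
  have hsplit : ∀ x y : ℝ≥0∞, (x ^ (1 / p) * y ^ (1 / q)) ^ r = x ^ (r / p) * y ^ (r / q) :=
    fun x y => by
      rw [ENNReal.mul_rpow_of_nonneg _ _ hr.le, ← ENNReal.rpow_mul, ← ENNReal.rpow_mul]
      congr 2 <;> ring
  simp_rw [hsplit]
  -- Hölder in the centre `a`, with weights `r/p` and `r/q` adding up to 1.
  refine (ENNReal.lintegral_mul_norm_pow_le
    (measurable_setLIntegral_ball (hF.pow_const p) R).aemeasurable
    (measurable_setLIntegral_ball (hG.pow_const q) R).aemeasurable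
    (by positivity) (by positivity) hpq).trans_eq ?_
  rw [lintegral_setLIntegral_ball (hF.pow_const p), lintegral_setLIntegral_ball (hG.pow_const q),
    ENNReal.mul_rpow_of_nonneg _ _ (by positivity), ENNReal.mul_rpow_of_nonneg _ _ (by positivity)]
  set v := volume (Metric.ball (0 : V) R)
  have hv : v ^ (r / p) * v ^ (r / q) = v := by
    rw [← ENNReal.rpow_add_of_nonneg _ _ (by positivity) (by positivity), hpq, ENNReal.rpow_one]
  calc _ = (v ^ (r / p) * v ^ (r / q)) * ((∫⁻ x, F x ^ p) ^ (r / p) *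
        (∫⁻ x, G x ^ q) ^ (r / q)) := by ring
    _ = _ := by rw [hv]

/-- `L^p × L^q → L^r` bound for bilinear convolution with an integrable kernel. -/
theorem lintegral_bilinear_convolution_le {p q r : ℝ} (hp : 0 < p) (hq : 0 < q) (hr : 1 ≤ r)
    (hpqr : 1 / r = 1 / p + 1 / q) {F G : V → ℝ≥0∞} (hF : Measurable F) (hG : Measurable G)
    {k : V × V → ℝ≥0∞} (hk : Measurable k) (S : Set (V × V)) :
    ∫⁻ x, (∫⁻ w in S, k w * (F (x - w.1) * G (x - w.2))) ^ r ≤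
      ((∫⁻ w in S, k w) *
        ((∫⁻ x, F x ^ p) ^ (1 / p) * (∫⁻ x, G x ^ q) ^ (1 / q))) ^ r := by
  have hr0 : 0 < r := by linarith
  have hpq : r / p + r / q = 1 := by
    rw [div_eq_mul_one_div r p, div_eq_mul_one_div r q, ← mul_add, ← hpqr]; field_simp
  have hH : Measurable fun z : V × (V × V) => F (z.1 - z.2.1) * G (z.1 - z.2.2) := by fun_prop
  -- Jensen for the measure `k dw`. For fixed `w` the integral in `x` is then handled by Hölder and
  -- translation invariance.
  have hpt : ∀ x, (∫⁻ w in S, k w * (F (x - w.1) * G (x - w.2))) ^ r ≤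
      (∫⁻ w in S, k w) ^ (r - 1) *
        ∫⁻ w in S, k w * (F (x - w.1) * G (x - w.2)) ^ r := fun x => by
    have hHx : Measurable fun w : V × V => F (x - w.1) * G (x - w.2) := by fun_prop
    have h := ENNReal.lintegral_mul_norm_pow_le (μ := volume.restrict S) (f := k)
      (g := fun w => k w * (F (x - w.1) * G (x - w.2)) ^ r) hk.aemeasurable
      (hk.mul (hHx.pow_const r)).aemeasurable (p := 1 - 1 / r) (q := 1 / r)
      (by rw [sub_nonneg, div_le_one hr0]; exact hr) (by positivity) (by ring)
    have e : ∀ w : V × V, k w ^ (1 - 1 / r) * (k w * (F (x - w.1) * G (x - w.2)) ^ r) ^ (1 / r) =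
        k w * (F (x - w.1) * G (x - w.2)) := fun w => by
      rw [ENNReal.mul_rpow_of_nonneg _ _ (by positivity), ← mul_assoc,
        ← ENNReal.rpow_add_of_nonneg _ _ (by rw [sub_nonneg, div_le_one hr0]; exact hr)
        (by positivity), ← ENNReal.rpow_mul, sub_add_cancel, mul_one_div_cancel hr0.ne']
      simp
    simp_rw [e] at h
    refine (ENNReal.rpow_le_rpow h hr0.le).trans_eq ?_
    rw [ENNReal.mul_rpow_of_nonneg _ _ hr0.le, ← ENNReal.rpow_mul, ← ENNReal.rpow_mul,
      one_div_mul_cancel hr0.ne', ENNReal.rpow_one, sub_mul, one_div_mul_cancel hr0.ne', one_mul]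
  have hx : ∀ w : V × V, ∫⁻ x, (F (x - w.1) * G (x - w.2)) ^ r ≤
      ((∫⁻ x, F x ^ p) ^ (1 / p) * (∫⁻ x, G x ^ q) ^ (1 / q)) ^ r := fun w => by
    have h := ENNReal.lintegral_mul_norm_pow_le (μ := (volume : Measure V))
      (f := fun x => F (x - w.1) ^ p) (g := fun x => G (x - w.2) ^ q)
      (by fun_prop) (by fun_prop) (p := r / p) (q := r / q) (by positivity) (by positivity) hpq
    rw [lintegral_sub_right_eq_self (fun x => F x ^ p),
      lintegral_sub_right_eq_self (fun x => G x ^ q)] at h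
    refine le_trans (le_of_eq ?_) (h.trans_eq ?_)
    · refine lintegral_congr fun x => ?_
      rw [ENNReal.mul_rpow_of_nonneg _ _ hr0.le, ← ENNReal.rpow_mul, ← ENNReal.rpow_mul,
        mul_div_cancel₀ _ hp.ne', mul_div_cancel₀ _ hq.ne']
    · rw [ENNReal.mul_rpow_of_nonneg _ _ hr0.le, ← ENNReal.rpow_mul, ← ENNReal.rpow_mul]
      congr 2 <;> ring
  set N := (∫⁻ x, F x ^ p) ^ (1 / p) * (∫⁻ x, G x ^ q) ^ (1 / q)
  have hm2 : Measurable fun z : V × (V × V) =>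
      k z.2 * (F (z.1 - z.2.1) * G (z.1 - z.2.2)) ^ r :=
    (hk.comp measurable_snd).mul (hH.pow_const r)
  calc _ ≤ ∫⁻ x, (∫⁻ w in S, k w) ^ (r - 1) *
        ∫⁻ w in S, k w * (F (x - w.1) * G (x - w.2)) ^ r := lintegral_mono hpt
    _ = (∫⁻ w in S, k w) ^ (r - 1) *
        ∫⁻ w in S, ∫⁻ x, k w * (F (x - w.1) * G (x - w.2)) ^ r := by
        rw [lintegral_const_mul _ hm2.lintegral_prod_right', lintegral_lintegral_swap
          hm2.aemeasurable]
    _ ≤ (∫⁻ w in S, k w) ^ (r - 1) * ∫⁻ w in S, k w * N ^ r := by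
        gcongr with w
        rw [lintegral_const_mul _ (by fun_prop)]
        gcongr
        exact hx w
    _ = _ := by
        rw [lintegral_mul_const _ hk]
        set I := ∫⁻ w in S, k w
        rw [ENNReal.mul_rpow_of_nonneg I N hr0.le, ← mul_assoc]
        congr 1
        calc I ^ (r - 1) * I = I ^ (r - 1) * I ^ (1 : ℝ) := by rw [ENNReal.rpow_one]
          _ = I ^ r := by
            rw [← ENNReal.rpow_add_of_nonneg _ _ (by linarith) zero_le_one, sub_add_cancel]

theorem continuous_shellOperator (φ : 𝓢(ℝ, ℂ)) (hφ : ∀ u ∉ Set.Icc (1 / 2 : ℝ) 2, φ u = 0) {t : ℝ}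
    (ht : 0 ≤ t) {f g : V → ℂ} (hf : Integrable f) (hg : Integrable g) :
    Continuous (shellOperator φ t f g) := by
  have hi : Integrable fun z : V × V => shellSymbol φ t z * 𝓕 f z.1 * 𝓕 g z.2 := by
    simp_rw [mul_assoc]
    refine (integrable_shellSymbol hφ ht).mul_bdd
      (c := (∫⁻ x, ‖f x‖ₑ).toReal * (∫⁻ x, ‖g x‖ₑ).toReal)
      (((continuous_fourier hf).comp continuous_fst).mul
        ((continuous_fourier hg).comp continuous_snd)).aestronglyMeasurable (.of_forall fun z => ?_)
    rw [norm_mul, ← toReal_enorm (𝓕 f z.1), ← toReal_enorm (𝓕 g z.2)]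
    exact mul_le_mul (ENNReal.toReal_mono hf.2.ne (enorm_fourier_le f _))
      (ENNReal.toReal_mono hg.2.ne (enorm_fourier_le g _)) ENNReal.toReal_nonneg
      ENNReal.toReal_nonneg
  refine continuous_of_dominated (fun x => aestronglyMeasurable_fourierChar_smul
    (by fun_prop) hi.1) (fun x => .of_forall fun z => (Circle.norm_smul _ _).le) hi.norm
    (.of_forall fun z => ?_)
  simp_rw [Circle.smul_def]
  exact (continuous_fourierChar_coe (by fun_prop)).smul continuous_const

/-- If `x` is in the ball of radius `R` and `‖w‖ < R`, then both `x - w.1` and `x - w.2` lie in the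
doubled ball, so the cutoffs change nothing. Only `‖w‖ ≥ R` contributes to the error. -/
theorem enorm_shellOperator_le_local {φ : 𝓢(ℝ, ℂ)} (hφ : ∀ u ∉ Set.Icc (1 / 2 : ℝ) 2, φ u = 0)
    {t : ℝ} (ht : 0 ≤ t) {f g : V → ℂ} (hf : Integrable f) (hg : Integrable g) {R : ℝ} {a x : V}
    (hx : x ∈ Metric.ball a R) :
    ‖shellOperator φ t f g x‖ₑ ≤
      ‖shellOperator φ t ((Metric.ball a (2 * R)).indicator f)
        ((Metric.ball a (2 * R)).indicator g) x‖ₑ +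
      ∫⁻ w in (Metric.ball (0 : V × V) R)ᶜ,
        ‖shellKernel φ t w‖ₑ * (‖f (x - w.1)‖ₑ * ‖g (x - w.2)‖ₑ) := by
  set Q := Metric.ball a (2 * R) with hQ
  have hf' : Integrable (Q.indicator f) := hf.indicator measurableSet_ball
  have hg' : Integrable (Q.indicator g) := hg.indicator measurableSet_ball
  have hKb : ∀ w : V × V, ‖shellKernel φ t w‖ ≤ ∫ z : V × V, ‖shellSymbol φ t z‖ := fun w =>
    (norm_integral_le_integral_norm _).trans_eq (by simp [Circle.norm_smul])
  have hint : ∀ {f g : V → ℂ}, Integrable f → Integrable g →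
      Integrable fun w : V × V => shellKernel φ t w * (f (x - w.1) * g (x - w.2)) :=
    fun {f g} hf hg => ((hf.comp_sub_left x).mul_prod (hg.comp_sub_left x)).bdd_mul
      (continuous_shellKernel hφ ht).aestronglyMeasurable (.of_forall hKb)
  have hsub : shellOperator φ t f g x = shellOperator φ t (Q.indicator f) (Q.indicator g) x +
      ∫ w : V × V, (shellKernel φ t w * (f (x - w.1) * g (x - w.2)) -
        shellKernel φ t w * (Q.indicator f (x - w.1) * Q.indicator g (x - w.2))) := by
    rw [integral_sub (hint hf hg) (hint hf' hg'), ← shellOperator_eq_integral_kernel hφ ht hf hg,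
      ← shellOperator_eq_integral_kernel hφ ht hf' hg']
    ring
  rw [hsub]
  refine (enorm_add_le _ _).trans ?_
  gcongr
  refine (enorm_integral_le_lintegral_enorm _).trans ?_
  rw [← lintegral_indicator measurableSet_ball.compl]
  refine lintegral_mono fun w => ?_
  by_cases hw : w ∈ Metric.ball (0 : V × V) R
  · have hmem : ∀ y : V, ‖y‖ ≤ ‖w‖ → x - y ∈ Q := fun y hy => by
      simp only [Metric.mem_ball, dist_zero_right] at hw hx
      rw [hQ, Metric.mem_ball, dist_eq_norm]
      rw [dist_eq_norm] at hx
      calc ‖x - y - a‖ = ‖(x - a) - y‖ := by congr 1; abel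
        _ ≤ ‖x - a‖ + ‖y‖ := norm_sub_le _ _
        _ < 2 * R := by linarith
    simp only
    rw [Set.indicator_of_mem (hmem _ (norm_fst_le w)), Set.indicator_of_mem (hmem _ (norm_snd_le w))]
    simp
  · rw [Set.indicator_of_mem (show w ∈ (Metric.ball (0 : V × V) R)ᶜ from hw)]
    simp only
    rw [← mul_sub, enorm_mul]
    refine mul_le_mul' le_rfl ?_
    by_cases h1 : x - w.1 ∈ Q <;> by_cases h2 : x - w.2 ∈ Q <;> simp [h1, h2, enorm_mul]

end Averaging

/-! ### Global `L^p × L^q → L^r` bound for one shell. -/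

section ShellBound

theorem eLpNorm'_indicator {α : Type*} [MeasurableSpace α] {μ : Measure α} {Q : Set α}
    (hQ : MeasurableSet Q) (f : α → ℂ) {p : ℝ} (hp : 0 < p) :
    eLpNorm' (Q.indicator f) p μ = (∫⁻ x in Q, ‖f x‖ₑ ^ p ∂μ) ^ (1 / p) := by
  rw [eLpNorm', ← lintegral_indicator hQ]
  congr 2; ext x
  by_cases hx : x ∈ Q
  · simp [hx]
  · simp [hx, ENNReal.zero_rpow_of_pos hp]

variable {V : Type*} [NormedAddCommGroup V] [InnerProductSpace ℝ V] [FiniteDimensional ℝ V]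
  [MeasurableSpace V] [BorelSpace V]

/-- The `L^p × L^q → L^r` bound for the shell operators, for `1/r = 1/p + 1/q`. -/
theorem exists_eLpNorm'_shellOperator_global_le (hn : 2 ≤ Module.finrank ℝ V) {φ : 𝓢(ℝ, ℂ)}
    (hφ : ∀ u ∉ Set.Icc (1 / 2 : ℝ) 2, φ u = 0) {p q r : ℝ} (hp : 1 < p) (hq : 1 < q)
    (hr : 1 ≤ r) (hpqr : 1 / r = 1 / p + 1 / q) {ε : ℝ} (hε : 0 < ε) :
    ∃ C : ℝ≥0∞, C ≠ ⊤ ∧ ∀ t : ℝ, 1 ≤ t → ∀ f g : V → ℂ, Continuous f → Continuous g →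
      Integrable f → Integrable g → MemLp f 2 → MemLp g 2 →
      eLpNorm' (shellOperator φ t f g) r volume ≤
        C * (ENNReal.ofReal t ^ (-shellGain r + (1 + ε) * (ballLoss V p + ballLoss V q)) + 1) *
          (eLpNorm' f p volume * eLpNorm' g q volume) := by
  have hr0 : 0 < r := by linarith
  have hp0 : 0 < p := by linarith
  have hq0 : 0 < q := by linarith
  have hfin : 0 < Module.finrank ℝ V := by omega
  have : Nontrivial V := Module.finrank_pos_iff (R := ℝ) |>.1 hfin
  obtain ⟨C, hC, hCb⟩ := exists_eLpNorm'_shellOperator_le hn hφ hp hq hr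
  obtain ⟨D, hD, hDb⟩ := exists_lintegral_shellKernel_tail_le (V := V) hφ hε
  set κ := ballLoss V p + ballLoss V q with hκ
  have hκ0 : 0 ≤ κ := add_nonneg (ballLoss_nonneg V p) (ballLoss_nonneg V q)
  -- The `r`-th root of the volume ratio `2^n` between balls of radii `2R` and `R`.
  set c₂ : ℝ≥0∞ := (2 : ℝ≥0∞) ^ ((Module.finrank ℝ V : ℝ) / r)
  refine ⟨2 * (C * 2 ^ κ * c₂ + D), ENNReal.mul_ne_top (by simp) (ENNReal.add_ne_top.2
    ⟨ENNReal.mul_ne_top (ENNReal.mul_ne_top hC (ENNReal.rpow_ne_top_of_nonneg hκ0 (by simp)))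
      (ENNReal.rpow_ne_top_of_nonneg (by positivity) (by simp)), hD⟩), ?_⟩
  intro t ht f g hfc hgc hf hg hf2 hg2
  have ht0 : 0 < t := by linarith
  set R := t ^ (1 + ε) with hR
  have hR1 : 1 ≤ R := Real.one_le_rpow ht (by linarith)
  set v := volume (Metric.ball (0 : V) R)
  have hv0 : v ≠ 0 := (Metric.measure_ball_pos _ _ (by linarith)).ne'
  have hvt : v ≠ ⊤ := measure_ball_lt_top.ne
  set T := shellOperator φ t f g
  have hTc : Continuous T := continuous_shellOperator φ hφ ht0.le hf hg
  set N := eLpNorm' f p volume * eLpNorm' g q volume with hN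
  let E : V → ℝ≥0∞ := fun x => ∫⁻ w in (Metric.ball (0 : V × V) R)ᶜ,
        ‖shellKernel φ t w‖ₑ * (‖f (x - w.1)‖ₑ * ‖g (x - w.2)‖ₑ)
  have hKm : Measurable fun w : V × V => ‖shellKernel φ t w‖ₑ :=
    (continuous_shellKernel hφ ht0.le).enorm.measurable
  have hfm : Measurable fun x => ‖f x‖ₑ := hfc.enorm.measurable
  have hgm : Measurable fun x => ‖g x‖ₑ := hgc.enorm.measurable
  have hEm : Measurable E := by
    have : Measurable fun z : V × (V × V) =>
        ‖shellKernel φ t z.2‖ₑ * (‖f (z.1 - z.2.1)‖ₑ * ‖g (z.1 - z.2.2)‖ₑ) :=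
      (hKm.comp measurable_snd).mul ((hfm.comp (by fun_prop)).mul (hgm.comp (by fun_prop)))
    exact this.lintegral_prod_right'
  have hE : ∫⁻ x, E x ^ r ≤ (D * N) ^ r := by
    refine (lintegral_bilinear_convolution_le hp0 hq0 hr hpqr hfm hgm hKm _).trans ?_
    have := hDb t ht
    gcongr
    rfl
  set A : ℝ≥0∞ := C * (ENNReal.ofReal t ^ (-shellGain r) * ENNReal.ofReal (2 * R) ^ κ) with hA
  -- The local bound is stated for `r`-th powers so that it can be integrated over the centres `a`;
  -- the factor `2^(r-1)` is convexity of the `r`-th power.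
  have hloc : ∀ a : V, ∫⁻ x in Metric.ball a R, ‖T x‖ₑ ^ r ≤
      2 ^ (r - 1) * (A ^ r * ((∫⁻ x in Metric.ball a (2 * R), ‖f x‖ₑ ^ p) ^ (1 / p) *
        (∫⁻ x in Metric.ball a (2 * R), ‖g x‖ₑ ^ q) ^ (1 / q)) ^ r +
        ∫⁻ x in Metric.ball a R, E x ^ r) := by
    intro a
    set Q := Metric.ball a (2 * R)
    have hTa := hCb t ht (2 * R) (by linarith) a (Q.indicator f) (Q.indicator g)
      (hf.indicator measurableSet_ball) (hg.indicator measurableSet_ball)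
      (hf2.indicator measurableSet_ball) (hg2.indicator measurableSet_ball)
      (fun x hx => Set.indicator_of_notMem hx _) (fun x hx => Set.indicator_of_notMem hx _)
    rw [eLpNorm'_indicator measurableSet_ball f hp0, eLpNorm'_indicator measurableSet_ball g hq0]
      at hTa
    set Ta := shellOperator φ t (Q.indicator f) (Q.indicator g)
    have hTar : ∫⁻ x, ‖Ta x‖ₑ ^ r ≤ A ^ r * ((∫⁻ x in Q, ‖f x‖ₑ ^ p) ^ (1 / p) *
        (∫⁻ x in Q, ‖g x‖ₑ ^ q) ^ (1 / q)) ^ r := by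
      rw [← ENNReal.mul_rpow_of_nonneg _ _ hr0.le]
      refine le_trans (le_of_eq ?_) (ENNReal.rpow_le_rpow hTa hr0.le)
      rw [eLpNorm', ← ENNReal.rpow_mul, one_div_mul_cancel hr0.ne', ENNReal.rpow_one]
    calc ∫⁻ x in Metric.ball a R, ‖T x‖ₑ ^ r
        ≤ ∫⁻ x in Metric.ball a R, 2 ^ (r - 1) * (‖Ta x‖ₑ ^ r + E x ^ r) := by
          refine setLIntegral_mono' measurableSet_ball fun x hx => ?_
          refine (ENNReal.rpow_le_rpow
            (enorm_shellOperator_le_local hφ ht0.le hf hg hx) hr0.le).trans ?_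
          exact ENNReal.rpow_add_le_mul_rpow_add_rpow _ _ hr
      _ = 2 ^ (r - 1) * ((∫⁻ x in Metric.ball a R, ‖Ta x‖ₑ ^ r) +
            ∫⁻ x in Metric.ball a R, E x ^ r) := by
          rw [lintegral_const_mul' _ _ (ENNReal.rpow_ne_top_of_nonneg (by linarith) (by simp)),
            lintegral_add_right _ (hEm.pow_const r)]
      _ ≤ _ := by
          gcongr
          exact (setLIntegral_le_lintegral _ _).trans hTar
  have hvol : volume (Metric.ball (0 : V) (2 * R)) = 2 ^ (Module.finrank ℝ V : ℝ) * v := by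
    rw [Measure.addHaar_ball_mul _ _ (by norm_num), ENNReal.ofReal_pow (by norm_num),
      ENNReal.rpow_natCast]
    simp [v]
  have hint : v * ∫⁻ x, ‖T x‖ₑ ^ r ≤ v * (2 ^ (r - 1) * ((A * c₂) ^ r * N ^ r + (D * N) ^ r)) := by
    rw [← lintegral_setLIntegral_ball (hTc.enorm.measurable.pow_const r)]
    refine (lintegral_mono hloc).trans ?_
    rw [lintegral_const_mul' _ _ (ENNReal.rpow_ne_top_of_nonneg (by linarith) (by simp)),
      lintegral_add_right _ (measurable_setLIntegral_ball (hEm.pow_const r) R),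
      lintegral_setLIntegral_ball (hEm.pow_const r)]
    have hAt : A ^ r ≠ ⊤ := ENNReal.rpow_ne_top_of_nonneg hr0.le (ENNReal.mul_ne_top hC
      (ENNReal.mul_ne_top (ENNReal.rpow_ne_top_of_ne_zero (by simpa using ht0) (by simp))
        (ENNReal.rpow_ne_top_of_nonneg hκ0 ENNReal.ofReal_ne_top)))
    rw [lintegral_const_mul' _ _ hAt]
    have h := lintegral_local_norms_le hp0 hq0 hr0 hpqr hfm hgm (2 * R)
    rw [hvol] at h
    have hc₂ : c₂ ^ r = 2 ^ (Module.finrank ℝ V : ℝ) := by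
      rw [← ENNReal.rpow_mul, div_mul_cancel₀ _ hr0.ne']
    calc _ ≤ 2 ^ (r - 1) * (A ^ r * (2 ^ (Module.finrank ℝ V : ℝ) * v * N ^ r) +
          v * (D * N) ^ r) := by gcongr; exact h
      _ = _ := by
        rw [ENNReal.mul_rpow_of_nonneg A _ hr0.le, hc₂]
        ring
  -- Averaging puts the volume of the ball of radius `R` on both sides, and it cancels.
  have hint' := (ENNReal.mul_le_mul_iff_right hv0 hvt).1 hint
  have hfinal : eLpNorm' T r volume ≤ 2 * (A * c₂ * N + D * N) := by
    rw [eLpNorm']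
    refine (ENNReal.rpow_le_rpow hint' (by positivity)).trans ?_
    rw [ENNReal.mul_rpow_of_nonneg _ _ (by positivity), ← ENNReal.rpow_mul,
      ← ENNReal.mul_rpow_of_nonneg _ _ hr0.le]
    gcongr
    · calc (2 : ℝ≥0∞) ^ ((r - 1) * (1 / r)) ≤ 2 ^ (1 : ℝ) := by
            refine ENNReal.rpow_le_rpow_of_exponent_le (by norm_num) ?_
            rw [mul_one_div, div_le_one hr0]; linarith
        _ = 2 := by simp
    · exact ENNReal.rpow_add_rpow_le_add _ _ hr
  refine hfinal.trans ?_
  have hAeq : A = C * 2 ^ κ * ENNReal.ofReal t ^ (-shellGain r + (1 + ε) * κ) := by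
    rw [hA, ENNReal.ofReal_mul (by norm_num), ENNReal.mul_rpow_of_nonneg _ _ hκ0, hR,
      ← ENNReal.ofReal_rpow_of_pos ht0, ← ENNReal.rpow_mul,
      ENNReal.rpow_add (-shellGain r) ((1 + ε) * κ) (by simpa using ht0) ENNReal.ofReal_ne_top,
      ENNReal.ofReal_ofNat]
    ring
  rw [hAeq]
  set τ := ENNReal.ofReal t ^ (-shellGain r + (1 + ε) * κ)
  -- The summand 1 next to `τ` accounts for the kernel tail, which is bounded but does not decay in
  -- `t`.
  calc 2 * (C * 2 ^ κ * τ * c₂ * N + D * N) = 2 * (C * 2 ^ κ * c₂ * τ + D * 1) * N := by ring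
    _ ≤ 2 * (C * 2 ^ κ * c₂ * (τ + 1) + D * (τ + 1)) * N := by
      gcongr
      · exact le_self_add
      · exact le_add_self
    _ = _ := by ring

end ShellBound

/-! ### Extension of bounded bilinear maps by density. -/

section Extension

variable {E₁ E₂ X₁ X₂ Y : Type*} [AddCommGroup E₁] [Module ℂ E₁] [AddCommGroup E₂] [Module ℂ E₂]
  [NormedAddCommGroup X₁] [NormedSpace ℂ X₁] [NormedAddCommGroup X₂] [NormedSpace ℂ X₂]
  [NormedAddCommGroup Y] [NormedSpace ℂ Y] [CompleteSpace Y]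

/-- A bounded bilinear map defined on dense subspaces extends to a bounded bilinear map. -/
theorem exists_bilinear_extension {e₁ : E₁ →ₗ[ℂ] X₁} {e₂ : E₂ →ₗ[ℂ] X₂} (h₁ : DenseRange e₁)
    (h₂ : DenseRange e₂) (B : E₁ →ₗ[ℂ] E₂ →ₗ[ℂ] Y) {C : ℝ} (hC : 0 ≤ C)
    (hB : ∀ x y, ‖B x y‖ ≤ C * ‖e₁ x‖ * ‖e₂ y‖) :
    ∃ T : X₁ →ₗ[ℂ] X₂ →ₗ[ℂ] Y, (∀ F G, ‖T F G‖ ≤ C * ‖F‖ * ‖G‖) ∧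
      ∀ x y, T (e₁ x) (e₂ y) = B x y := by
  have heq : ∀ x y, (B x).extendOfNorm e₂ (e₂ y) = B x y := fun x y =>
    LinearMap.extendOfNorm_eq h₂ ⟨C * ‖e₁ x‖, hB x⟩ y
  -- The second variable is extended first, for each fixed `x`; uniqueness of extensions makes the
  -- result linear in `x`, so this operator-valued map can be extended in turn.
  let T₁ : E₁ →ₗ[ℂ] X₂ →L[ℂ] Y :=
    { toFun := fun x => (B x).extendOfNorm e₂
      map_add' := fun x x' => LinearMap.extendOfNorm_unique h₂ _ (hB (x + x')) _ (by
        ext y; simp [heq])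
      map_smul' := fun c x => LinearMap.extendOfNorm_unique h₂ _ (hB (c • x)) _ (by
        ext y; simp [heq]) }
  have hT₁ : ∀ x, ‖T₁ x‖ ≤ C * ‖e₁ x‖ := fun x =>
    LinearMap.opNorm_extendOfNorm_le h₂ (by positivity) (hB x)
  let T := T₁.extendOfNorm e₁
  refine ⟨(ContinuousLinearMap.coeLM ℂ).comp T.toLinearMap, fun F G => ?_, fun x y => ?_⟩
  · refine ((T F).le_opNorm G).trans ?_
    gcongr
    exact LinearMap.norm_extendOfNorm_apply_le h₁ C hT₁ F
  · have : T (e₁ x) = T₁ x := LinearMap.extendOfNorm_eq h₁ ⟨C, hT₁⟩ x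
    change T (e₁ x) (e₂ y) = _
    rw [this]
    exact heq x y

end Extension

/-! ### Smooth dyadic partition. -/

section Dyadic

open Real in
/-- A smooth dyadic partition function supported in `[1/2, 2]`. -/
noncomputable def dyadicBump (u : ℝ) : ℝ := smoothTransition (2 * u - 1) - smoothTransition (u - 1)

theorem dyadicBump_of_le {u : ℝ} (hu : u ≤ 1 / 2) : dyadicBump u = 0 := by
  rw [dyadicBump, Real.smoothTransition.zero_of_nonpos (by linarith),
    Real.smoothTransition.zero_of_nonpos (by linarith), sub_zero]

theorem dyadicBump_of_ge {u : ℝ} (hu : 2 ≤ u) : dyadicBump u = 0 := by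
  rw [dyadicBump, Real.smoothTransition.one_of_one_le (by linarith),
    Real.smoothTransition.one_of_one_le (by linarith), sub_self]

theorem contDiff_dyadicBump (N : ℕ∞) : ContDiff ℝ N dyadicBump :=
  (Real.smoothTransition.contDiff.comp (by fun_prop)).sub
    (Real.smoothTransition.contDiff.comp (by fun_prop))

/-- The dyadic profile `u^δ ψ(u)`. -/
noncomputable def dyadicProfile (δ u : ℝ) : ℂ := ((u ^ δ * dyadicBump u : ℝ) : ℂ)

theorem dyadicProfile_eq_zero {δ u : ℝ} (hu : u ∉ Set.Icc (1 / 2 : ℝ) 2) :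
    dyadicProfile δ u = 0 := by
  rw [Set.mem_Icc, not_and_or, not_le, not_le] at hu
  rcases hu with hu | hu
  · simp [dyadicProfile, dyadicBump_of_le hu.le]
  · simp [dyadicProfile, dyadicBump_of_ge hu.le]

theorem contDiff_dyadicProfile (δ : ℝ) : ContDiff ℝ (⊤ : ℕ∞) (dyadicProfile δ) := by
  refine Complex.ofRealCLM.contDiff.comp (contDiff_iff_contDiffAt.2 fun u => ?_)
  by_cases hu : u < 1 / 2
  · refine (contDiffAt_const (c := (0 : ℝ))).congr_of_eventuallyEq ?_
    filter_upwards [Iio_mem_nhds hu] with v hv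
    change v ^ δ * dyadicBump v = 0
    rw [dyadicBump_of_le (le_of_lt hv), mul_zero]
  · exact (Real.contDiffAt_rpow_const_of_ne (by linarith)).mul (contDiff_dyadicBump _).contDiffAt

theorem hasCompactSupport_dyadicProfile (δ : ℝ) : HasCompactSupport (dyadicProfile δ) :=
  HasCompactSupport.intro isCompact_Icc fun _ hu => dyadicProfile_eq_zero hu

/-- The dyadic profile as a Schwartz function. -/
noncomputable def dyadicSchwartz (δ : ℝ) : 𝓢(ℝ, ℂ) :=
  (hasCompactSupport_dyadicProfile δ).toSchwartzMap (contDiff_dyadicProfile δ)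

/-- The factors `2^(-jδ)` and `(2^j s)^δ` combine to `s^δ`, and the bumps telescope. The boundary
term at `j = 0` vanishes because `s ≤ 1`, so nonnegative `j` suffice. -/
theorem sum_dyadicProfile {δ s : ℝ} (hs : s ≤ 1) (J : ℕ) :
    ∑ j ∈ Finset.range J, (((2 : ℝ) ^ j) ^ (-δ) : ℝ) * dyadicProfile δ (2 ^ j * s) =
      ((s ^ δ * Real.smoothTransition (2 ^ J * s - 1) : ℝ) : ℂ) := by
  rcases le_or_gt s 0 with hs0 | hs0
  · rw [Real.smoothTransition.zero_of_nonpos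
      (by nlinarith [pow_pos (two_pos (α := ℝ)) J]), mul_zero, Complex.ofReal_zero]
    refine Finset.sum_eq_zero fun j _ => ?_
    rw [dyadicProfile_eq_zero, mul_zero]
    intro h
    nlinarith [pow_pos (two_pos (α := ℝ)) j, h.1]
  · have h : ∀ j : ℕ, (((2 : ℝ) ^ j) ^ (-δ) : ℝ) * dyadicProfile δ (2 ^ j * s) =
        ((s ^ δ * (Real.smoothTransition (2 ^ (j + 1) * s - 1) -
          Real.smoothTransition (2 ^ j * s - 1)) : ℝ) : ℂ) := fun j => by
      rw [dyadicProfile, dyadicBump, ← Complex.ofReal_mul, Real.mul_rpow (by positivity) hs0.le,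
        Real.rpow_neg (by positivity), ← mul_assoc, ← mul_assoc,
        inv_mul_cancel₀ (by positivity), one_mul]
      congr 4
      ring
    simp_rw [h]
    rw [← Complex.ofReal_sum, ← Finset.mul_sum,
      Finset.sum_range_sub (fun j => Real.smoothTransition (2 ^ j * s - 1)),
      Real.smoothTransition.zero_of_nonpos (x := 2 ^ 0 * s - 1) (by linarith), sub_zero]

end Dyadic

/-! ### Summation of the shells. -/

section BochnerRiesz

open Filter Topology

variable {V : Type*} [NormedAddCommGroup V]

/-- The symbol `(1 - |ξ|² - |η|²)₊^δ`. -/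
noncomputable def brSymbol (δ : ℝ) : V × V → ℂ :=
  {z : V × V | ‖z.1‖ ^ 2 + ‖z.2‖ ^ 2 ≤ 1}.indicator
    fun z => (((1 - ‖z.1‖ ^ 2 - ‖z.2‖ ^ 2) ^ δ : ℝ) : ℂ)

/-- The partial sums of the dyadic decomposition of `brSymbol`. -/
noncomputable def brPartialSymbol (δ : ℝ) (J : ℕ) (z : V × V) : ℂ :=
  ∑ j ∈ Finset.range J, (((2 : ℝ) ^ j) ^ (-δ) : ℝ) * shellSymbol (dyadicSchwartz δ) (2 ^ j) z

theorem brPartialSymbol_eq (δ : ℝ) (J : ℕ) (z : V × V) :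
    brPartialSymbol δ J z = (((1 - ‖z.1‖ ^ 2 - ‖z.2‖ ^ 2) ^ δ *
      Real.smoothTransition (2 ^ J * (1 - ‖z.1‖ ^ 2 - ‖z.2‖ ^ 2) - 1) : ℝ) : ℂ) :=
  sum_dyadicProfile (by nlinarith [sq_nonneg ‖z.1‖, sq_nonneg ‖z.2‖]) J

theorem norm_brPartialSymbol_le {δ : ℝ} (hδ : 0 < δ) (J : ℕ) (z : V × V) :
    ‖brPartialSymbol δ J z‖ ≤ 1 := by
  rw [brPartialSymbol_eq, Complex.norm_real]
  set s := 1 - ‖z.1‖ ^ 2 - ‖z.2‖ ^ 2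
  have hs : s ≤ 1 := by simp only [s]; nlinarith [sq_nonneg ‖z.1‖, sq_nonneg ‖z.2‖]
  rcases le_or_gt s 0 with h | h
  · rw [Real.smoothTransition.zero_of_nonpos (by nlinarith [pow_pos (two_pos (α := ℝ)) J])]
    simp
  · rw [Real.norm_of_nonneg (mul_nonneg (Real.rpow_nonneg h.le _)
      (Real.smoothTransition.nonneg _))]
    exact mul_le_one₀ (Real.rpow_le_one h.le hs hδ.le) (Real.smoothTransition.nonneg _)
      (Real.smoothTransition.le_one _)

/-- Inside the sphere the sequence is constant once `2^J s ≥ 2`; elsewhere it is zero. On the sphere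
itself the limit is correct because `0^δ = 0` for `δ > 0`. -/
theorem tendsto_brPartialSymbol {δ : ℝ} (hδ : 0 < δ) (z : V × V) :
    Tendsto (fun J => brPartialSymbol δ J z) atTop (𝓝 (brSymbol δ z)) := by
  simp only [brPartialSymbol_eq]
  set s := 1 - ‖z.1‖ ^ 2 - ‖z.2‖ ^ 2 with hs
  have hmem : z ∈ {z : V × V | ‖z.1‖ ^ 2 + ‖z.2‖ ^ 2 ≤ 1} ↔ 0 ≤ s := by
    rw [Set.mem_ofPred_eq, hs]; constructor <;> intro h <;> linarith
  rcases le_or_gt s 0 with h | h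
  · have h0 : brSymbol δ z = 0 := by
      by_cases hz : z ∈ {z : V × V | ‖z.1‖ ^ 2 + ‖z.2‖ ^ 2 ≤ 1}
      · rw [brSymbol, Set.indicator_of_mem hz, ← hs, le_antisymm h (hmem.1 hz),
          Real.zero_rpow hδ.ne', Complex.ofReal_zero]
      · rw [brSymbol, Set.indicator_of_notMem hz]
    rw [h0]
    refine tendsto_const_nhds.congr fun J => ?_
    rw [Real.smoothTransition.zero_of_nonpos (by nlinarith [pow_pos (two_pos (α := ℝ)) J]),
      mul_zero, Complex.ofReal_zero]
  · have h0 : brSymbol δ z = ((s ^ δ : ℝ) : ℂ) := by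
      rw [brSymbol, Set.indicator_of_mem (hmem.2 h.le), ← hs]
    rw [h0]
    refine tendsto_const_nhds.congr' ?_
    filter_upwards [(tendsto_pow_atTop_atTop_of_one_lt (one_lt_two (α := ℝ))).eventually_ge_atTop
      (2 / s)] with J hJ
    rw [div_le_iff₀ h] at hJ
    rw [Real.smoothTransition.one_of_one_le (by linarith), mul_one]

theorem norm_brSymbol_le {δ : ℝ} (hδ : 0 < δ) (z : V × V) : ‖brSymbol δ z‖ ≤ 1 :=
  le_of_tendsto (tendsto_brPartialSymbol hδ z).norm (.of_forall fun J =>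
    norm_brPartialSymbol_le hδ J z)

variable [InnerProductSpace ℝ V] [FiniteDimensional ℝ V] [MeasurableSpace V] [BorelSpace V]

theorem aestronglyMeasurable_brPartialSymbol (δ : ℝ) (J : ℕ) :
    AEStronglyMeasurable (brPartialSymbol δ J : V × V → ℂ) :=
  (continuous_finsetSum _ fun _ _ =>
    continuous_const.mul (continuous_shellSymbol _ _)).aestronglyMeasurable

theorem aestronglyMeasurable_brSymbol {δ : ℝ} (hδ : 0 < δ) :
    AEStronglyMeasurable (brSymbol δ : V × V → ℂ) :=
  aestronglyMeasurable_of_tendsto_ae _ (fun J => aestronglyMeasurable_brPartialSymbol δ J)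
    (.of_forall fun z => tendsto_brPartialSymbol hδ z)

theorem integrable_brSymbol_mul {δ : ℝ} (hδ : 0 < δ) {U W : V → ℂ} (hU : Integrable U)
    (hW : Integrable W) : Integrable fun z : V × V => brSymbol δ z * U z.1 * W z.2 := by
  simp_rw [mul_assoc]
  exact (hU.mul_prod hW).bdd_mul (aestronglyMeasurable_brSymbol hδ)
    (.of_forall (norm_brSymbol_le hδ))

theorem continuous_bilinearMultiplier_brSymbol {δ : ℝ} (hδ : 0 < δ) {U W : V → ℂ}
    (hU : Integrable U) (hW : Integrable W) : Continuous (bilinearMultiplier (brSymbol δ) U W) := by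
  have hi := integrable_brSymbol_mul hδ hU hW
  refine continuous_of_dominated (fun x => aestronglyMeasurable_fourierChar_smul
    (by fun_prop) hi.1) (fun x => .of_forall fun z => (Circle.norm_smul _ _).le) hi.norm
    (.of_forall fun z => ?_)
  simp_rw [Circle.smul_def]
  exact (continuous_fourierChar_coe (by fun_prop)).smul continuous_const

theorem tendsto_sum_shellOperator {δ : ℝ} (hδ : 0 < δ) {f g : V → ℂ} (hf : Integrable (𝓕 f))
    (hg : Integrable (𝓕 g)) (x : V) :
    Tendsto (fun J : ℕ => (∑ j ∈ Finset.range J, ((((2 : ℝ) ^ j) ^ (-δ) : ℝ) : ℂ) •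
      shellOperator (dyadicSchwartz δ) (2 ^ j) f g) x) atTop
      (𝓝 (bilinearMultiplier (brSymbol δ) (𝓕 f) (𝓕 g) x)) := by
  have hfg := hf.mul_prod hg
  have hterm : ∀ j : ℕ, Integrable fun z : V × V => Real.fourierChar ⟪x, z.1 + z.2⟫ •
      (shellSymbol (dyadicSchwartz δ) (2 ^ j) z * 𝓕 f z.1 * 𝓕 g z.2) := fun j => by
    obtain ⟨M, -, hM⟩ := exists_norm_shellSymbol_le (V := V) (dyadicSchwartz δ)
    exact integrable_fourierChar_smul (by fun_prop)
      (integrable_symbol_mul (continuous_shellSymbol _ _) (hM _) hf hg)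
  have heq : ∀ J : ℕ, (∑ j ∈ Finset.range J, ((((2 : ℝ) ^ j) ^ (-δ) : ℝ) : ℂ) •
      shellOperator (dyadicSchwartz δ) (2 ^ j) f g) x =
      ∫ z : V × V, Real.fourierChar ⟪x, z.1 + z.2⟫ •
        (brPartialSymbol δ J z * 𝓕 f z.1 * 𝓕 g z.2) := fun J => by
    simp only [Finset.sum_apply, Pi.smul_apply, shellOperator, bilinearMultiplier]
    simp_rw [← integral_smul]
    refine (integral_finsetSum _ fun j _ =>
      (hterm j).smul ((((2 : ℝ) ^ j) ^ (-δ) : ℝ) : ℂ)).symm.trans ?_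
    refine integral_congr_ae (.of_forall fun z => ?_)
    simp only [brPartialSymbol, Pi.smul_apply, Circle.smul_def, smul_eq_mul, Finset.sum_mul, Finset.mul_sum]
    refine Finset.sum_congr rfl fun j _ => ?_
    ring
  simp_rw [heq]
  refine tendsto_integral_of_dominated_convergence (fun z : V × V => ‖𝓕 f z.1 * 𝓕 g z.2‖)
    (fun J => ?_) hfg.norm (fun J => .of_forall fun z => ?_) (.of_forall fun z => ?_)
  · refine aestronglyMeasurable_fourierChar_smul (by fun_prop) ?_
    simp_rw [mul_assoc]
    exact (aestronglyMeasurable_brPartialSymbol δ J).mul hfg.1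
  · rw [Circle.norm_smul, mul_assoc, norm_mul]
    exact mul_le_of_le_one_left (norm_nonneg _) (norm_brPartialSymbol_le hδ J z)
  · exact (((tendsto_brPartialSymbol hδ z).mul_const _).mul_const _).const_smul _

/-- The `L^p × L^q → L^r` bound for the bilinear Bochner-Riesz operator on nice functions. -/
theorem exists_eLpNorm'_brOperator_le (hn : 2 ≤ Module.finrank ℝ V) {p q r δ : ℝ} (hp : 1 < p)
    (hq : 1 < q) (hr : 1 ≤ r) (hpqr : 1 / r = 1 / p + 1 / q) (hδ : 0 < δ)
    (hδ' : ballLoss V p + ballLoss V q - shellGain r < δ) :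
    ∃ C : ℝ≥0∞, C ≠ ⊤ ∧ ∀ f g : 𝓢(V, ℂ),
      eLpNorm' (bilinearMultiplier (brSymbol δ) (𝓕 (f : V → ℂ)) (𝓕 (g : V → ℂ))) r volume ≤
        C * (eLpNorm' f p volume * eLpNorm' g q volume) := by
  have hr0 : 0 < r := by linarith
  set κ := ballLoss V p + ballLoss V q with hκ
  have hκ0 : 0 ≤ κ := add_nonneg (ballLoss_nonneg V p) (ballLoss_nonneg V q)
  -- Small enough that replacing `κ` by `(1 + ε)κ` keeps the exponent below `δ`; the `+ 1` covers `κ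
  -- = 0`.
  set ε := (δ + shellGain r - κ) / (2 * (κ + 1)) with hε
  have hε0 : 0 < ε := div_pos (by linarith) (by positivity)
  have hεκ : ε * κ < δ + shellGain r - κ := by
    rw [hε, div_mul_eq_mul_div, div_lt_iff₀ (by positivity)]
    nlinarith
  set γ := -shellGain r + (1 + ε) * κ with hγ
  have hγδ : γ < δ := by rw [hγ]; linarith
  obtain ⟨C, hC, hCb⟩ := exists_eLpNorm'_shellOperator_global_le hn
    (φ := dyadicSchwartz δ) (fun u hu => dyadicProfile_eq_zero hu) hp hq hr hpqr hε0
  have h2j : ∀ j : ℕ, ENNReal.ofReal (2 ^ j) = 2 ^ (j : ℝ) := fun j => by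
    rw [ENNReal.ofReal_pow (by norm_num), ENNReal.rpow_natCast, ENNReal.ofReal_ofNat]
  have hlt : ∀ s : ℝ, s < 0 → (2 : ℝ≥0∞) ^ s < 1 := fun s hs =>
    ENNReal.rpow_lt_one_of_one_lt_of_neg (by norm_num) hs
  -- Sums of the two geometric series, for the main term and the kernel tail. The second converges
  -- because `δ > 0`.
  set D : ℝ≥0∞ := (1 - (2 : ℝ≥0∞) ^ (γ - δ))⁻¹ + (1 - (2 : ℝ≥0∞) ^ (-δ))⁻¹
  have hD : D ≠ ⊤ := ENNReal.add_ne_top.2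
    ⟨ENNReal.inv_ne_top.2 (tsub_pos_of_lt (hlt _ (by linarith))).ne',
      ENNReal.inv_ne_top.2 (tsub_pos_of_lt (hlt _ (by linarith))).ne'⟩
  refine ⟨C * D, ENNReal.mul_ne_top hC hD, fun f g => ?_⟩
  set N := eLpNorm' f p volume * eLpNorm' g q volume
  have hFf : Integrable (𝓕 (f : V → ℂ)) := by
    rw [← SchwartzMap.fourier_coe]; exact (𝓕 f).integrable
  have hFg : Integrable (𝓕 (g : V → ℂ)) := by
    rw [← SchwartzMap.fourier_coe]; exact (𝓕 g).integrable
  have hcont : ∀ j : ℕ, Continuous (shellOperator (dyadicSchwartz δ) (2 ^ j) (f : V → ℂ) g) :=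
    fun j => continuous_shellOperator _ (fun u hu => dyadicProfile_eq_zero hu) (by positivity)
      f.integrable g.integrable
  have hsum : ∀ J : ℕ, eLpNorm' (∑ j ∈ Finset.range J, ((((2 : ℝ) ^ j) ^ (-δ) : ℝ) : ℂ) •
      shellOperator (dyadicSchwartz δ) (2 ^ j) (f : V → ℂ) g) r volume ≤ C * D * N := by
    intro J
    refine (eLpNorm'_sum_le (fun j _ => ((hcont j).const_smul _).aestronglyMeasurable) hr).trans ?_
    have hj : ∀ j : ℕ, eLpNorm' (((((2 : ℝ) ^ j) ^ (-δ) : ℝ) : ℂ) •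
        shellOperator (dyadicSchwartz δ) (2 ^ j) (f : V → ℂ) g) r volume ≤
        C * N * (((2 : ℝ≥0∞) ^ (γ - δ)) ^ j + ((2 : ℝ≥0∞) ^ (-δ)) ^ j) := fun j => by
      rw [eLpNorm'_const_smul _ hr0]
      have hnorm : ‖((((2 : ℝ) ^ j) ^ (-δ) : ℝ) : ℂ)‖ₑ = ((2 : ℝ≥0∞) ^ (-δ)) ^ j := by
        rw [← ofReal_norm, Complex.norm_real, Real.norm_of_nonneg (by positivity),
          ← ENNReal.ofReal_rpow_of_pos (by positivity), h2j, ← ENNReal.rpow_mul,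
          ← ENNReal.rpow_natCast, ← ENNReal.rpow_mul, mul_comm]
      rw [hnorm]
      refine (mul_le_mul' le_rfl (hCb (2 ^ j) (one_le_pow₀ one_le_two) f g f.continuous
        g.continuous f.integrable g.integrable (f.memLp 2) (g.memLp 2))).trans_eq ?_
      have e1 : ENNReal.ofReal (2 ^ j) ^ γ = ((2 : ℝ≥0∞) ^ γ) ^ j := by
        rw [h2j, ← ENNReal.rpow_mul, ← ENNReal.rpow_natCast, ← ENNReal.rpow_mul, mul_comm]
      have e2 : (2 : ℝ≥0∞) ^ (γ - δ) = 2 ^ γ * 2 ^ (-δ) := by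
        rw [← ENNReal.rpow_add _ _ (by simp) (by simp), sub_eq_add_neg]
      rw [e1, e2, mul_pow]
      ring
    calc _ ≤ ∑ j ∈ Finset.range J,
          C * N * (((2 : ℝ≥0∞) ^ (γ - δ)) ^ j + ((2 : ℝ≥0∞) ^ (-δ)) ^ j) :=
          Finset.sum_le_sum fun j _ => hj j
      _ = C * N * (∑ j ∈ Finset.range J, ((2 : ℝ≥0∞) ^ (γ - δ)) ^ j +
            ∑ j ∈ Finset.range J, ((2 : ℝ≥0∞) ^ (-δ)) ^ j) := by
          rw [← Finset.mul_sum, Finset.sum_add_distrib]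
      _ ≤ C * N * D := by
          refine mul_le_mul' le_rfl (add_le_add ?_ ?_) <;>
          · rw [← ENNReal.tsum_geometric]; exact ENNReal.sum_le_tsum _
      _ = _ := by ring
  -- Fatou: the partial sums converge pointwise and are bounded uniformly in `J`.
  refine (Lp.eLpNorm'_lim_le_liminf_eLpNorm' hr0
    (fun J => Finset.aestronglyMeasurable_sum _ fun j _ =>
      ((hcont j).const_smul _).aestronglyMeasurable)
    (.of_forall fun x => tendsto_sum_shellOperator hδ hFf hFg x)).trans ?_
  exact liminf_le_of_le (by isBoundedDefault) fun b hb => by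
    obtain ⟨J, hJ⟩ := hb.exists
    exact hJ.trans (hsum J)

end BochnerRiesz

/-! ### Bilinearity, extension to `L^p × L^q`, and the exponent count. -/

section Main

theorem bilinearBochnerRiesz_eq (n : ℕ) (δ : ℝ) (f g : 𝓢(EuclideanSpace ℝ (Fin n), ℂ)) :
    bilinearBochnerRiesz n δ f g = bilinearMultiplier (brSymbol δ)
      (𝓕 (f : EuclideanSpace ℝ (Fin n) → ℂ)) (𝓕 (g : EuclideanSpace ℝ (Fin n) → ℂ)) := by
  ext x
  have hS : MeasurableSet {z : EuclideanSpace ℝ (Fin n) × EuclideanSpace ℝ (Fin n) |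
      ‖z.1‖ ^ 2 + ‖z.2‖ ^ 2 ≤ 1} :=
    (isClosed_le (by fun_prop) continuous_const).measurableSet
  rw [bilinearBochnerRiesz, ← integral_indicator hS, bilinearMultiplier]
  refine integral_congr_ae (.of_forall fun z => ?_)
  by_cases hz : z ∈ {z : EuclideanSpace ℝ (Fin n) × EuclideanSpace ℝ (Fin n) |
      ‖z.1‖ ^ 2 + ‖z.2‖ ^ 2 ≤ 1}
  · simp only [brSymbol, Set.indicator_of_mem hz, Circle.smul_def, Real.fourierChar_apply,
      smul_eq_mul]
    have h : (2 * Real.pi * Complex.I * (inner ℝ x (z.1 + z.2) : ℝ) : ℂ) =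
        ((2 * Real.pi * inner ℝ x (z.1 + z.2) : ℝ) : ℂ) * Complex.I := by
      push_cast
      ring
    rw [h]
    simp only [mul_assoc]
  · simp [brSymbol, Set.indicator_of_notMem hz]

/-- An operator which is bilinear on Schwartz functions and satisfies an `L^p × L^q → L^r`
estimate there extends to a bounded bilinear operator. -/
theorem isBoundedBilinearOp_of_eLpNorm_le {n : ℕ} {p q r : ℝ} (hp : 1 ≤ p) (hq : 1 ≤ q)
    (hr : 1 ≤ r)
    {S : 𝓢(EuclideanSpace ℝ (Fin n), ℂ) → 𝓢(EuclideanSpace ℝ (Fin n), ℂ) →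
      EuclideanSpace ℝ (Fin n) → ℂ}
    (hadd₁ : ∀ f f' g, S (f + f') g = S f g + S f' g)
    (hadd₂ : ∀ f g g', S f (g + g') = S f g + S f g')
    (hsmul₁ : ∀ (c : ℂ) f g, S (c • f) g = c • S f g)
    (hsmul₂ : ∀ (c : ℂ) f g, S f (c • g) = c • S f g)
    (hS : ∀ f g, AEStronglyMeasurable (S f g) volume) {C : ℝ≥0∞} (hC : C ≠ ⊤)
    (hbound : ∀ f g, eLpNorm (S f g) (ENNReal.ofReal r) volume ≤
      C * (eLpNorm f (ENNReal.ofReal p) volume * eLpNorm g (ENNReal.ofReal q) volume)) :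
    IsBoundedBilinearOp n p q r S := by
  have : Fact (1 ≤ ENNReal.ofReal p) := ⟨ENNReal.one_le_ofReal.2 hp⟩
  have : Fact (1 ≤ ENNReal.ofReal q) := ⟨ENNReal.one_le_ofReal.2 hq⟩
  have : Fact (1 ≤ ENNReal.ofReal r) := ⟨ENNReal.one_le_ofReal.2 hr⟩
  have hfin : ∀ f g : 𝓢(EuclideanSpace ℝ (Fin n), ℂ),
      C * (eLpNorm f (ENNReal.ofReal p) volume * eLpNorm g (ENNReal.ofReal q) volume) ≠ ⊤ :=
    fun f g => ENNReal.mul_ne_top hC (ENNReal.mul_ne_top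
      (f.memLp (ENNReal.ofReal p) volume).eLpNorm_ne_top
      (g.memLp (ENNReal.ofReal q) volume).eLpNorm_ne_top)
  have hmem : ∀ f g, MemLp (S f g) (ENNReal.ofReal r) volume := fun f g =>
    ⟨hS f g, (hbound f g).trans_lt (hfin f g).lt_top⟩
  have hcongr : ∀ {F G : EuclideanSpace ℝ (Fin n) → ℂ} (hF : MemLp F (ENNReal.ofReal r) volume)
      (hG : MemLp G (ENNReal.ofReal r) volume), F = G → hF.toLp F = hG.toLp G :=
    fun hF hG h => MemLp.toLp_congr hF hG (.of_eq h)
  let B : 𝓢(EuclideanSpace ℝ (Fin n), ℂ) →ₗ[ℂ] 𝓢(EuclideanSpace ℝ (Fin n), ℂ) →ₗ[ℂ]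
      Lp (α := EuclideanSpace ℝ (Fin n)) ℂ (ENNReal.ofReal r) volume :=
    LinearMap.mk₂ ℂ (fun f g => (hmem f g).toLp (S f g))
      (fun f f' g => (hcongr _ ((hmem f g).add (hmem f' g)) (hadd₁ f f' g)).trans
        (MemLp.toLp_add _ _))
      (fun c f g => (hcongr _ ((hmem f g).const_smul c) (hsmul₁ c f g)).trans
        (MemLp.toLp_const_smul c _))
      (fun f g g' => (hcongr _ ((hmem f g).add (hmem f g')) (hadd₂ f g g')).trans
        (MemLp.toLp_add _ _))
      (fun c f g => (hcongr _ ((hmem f g).const_smul c) (hsmul₂ c f g)).trans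
        (MemLp.toLp_const_smul c _))
  have hB : ∀ f g, ‖B f g‖ ≤ C.toReal *
      ‖(toLpCLM ℂ ℂ (ENNReal.ofReal p)
        (volume : Measure (EuclideanSpace ℝ (Fin n)))).toLinearMap f‖ *
      ‖(toLpCLM ℂ ℂ (ENNReal.ofReal q)
        (volume : Measure (EuclideanSpace ℝ (Fin n)))).toLinearMap g‖ := fun f g => by
    change ‖(hmem f g).toLp (S f g)‖ ≤ C.toReal * ‖f.toLp _ volume‖ * ‖g.toLp _ volume‖
    rw [Lp.norm_toLp, SchwartzMap.norm_toLp, SchwartzMap.norm_toLp, mul_assoc,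
      ← ENNReal.toReal_mul, ← ENNReal.toReal_mul]
    exact ENNReal.toReal_mono (hfin f g) (hbound f g)
  have h₁ : DenseRange (toLpCLM ℂ ℂ (ENNReal.ofReal p)
      (volume : Measure (EuclideanSpace ℝ (Fin n)))) := denseRange_toLpCLM ENNReal.ofReal_ne_top
  have h₂ : DenseRange (toLpCLM ℂ ℂ (ENNReal.ofReal q)
      (volume : Measure (EuclideanSpace ℝ (Fin n)))) := denseRange_toLpCLM ENNReal.ofReal_ne_top
  obtain ⟨T, hT, hTB⟩ := exists_bilinear_extension h₁ h₂ B ENNReal.toReal_nonneg hB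
  refine ⟨T, C.toReal, hT, fun f g => ?_⟩
  have h : T (f.toLp _ volume) (g.toLp _ volume) = (hmem f g).toLp (S f g) := hTB f g
  rw [h]
  exact MemLp.coeFn_toLp _

section Bilinear

variable {n : ℕ} {δ : ℝ}

theorem integrable_fourier (f : 𝓢(EuclideanSpace ℝ (Fin n), ℂ)) :
    Integrable (𝓕 (f : EuclideanSpace ℝ (Fin n) → ℂ)) := by
  rw [← SchwartzMap.fourier_coe]
  exact (𝓕 f).integrable

theorem fourier_add_apply (f g : 𝓢(EuclideanSpace ℝ (Fin n), ℂ)) (x : EuclideanSpace ℝ (Fin n)) :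
    𝓕 ((f + g : 𝓢(EuclideanSpace ℝ (Fin n), ℂ)) : EuclideanSpace ℝ (Fin n) → ℂ) x =
      𝓕 (f : EuclideanSpace ℝ (Fin n) → ℂ) x + 𝓕 (g : EuclideanSpace ℝ (Fin n) → ℂ) x := by
  simp only [← SchwartzMap.fourier_coe, FourierTransform.fourier_add]
  rfl

theorem fourier_smul_apply (c : ℂ) (f : 𝓢(EuclideanSpace ℝ (Fin n), ℂ))
    (x : EuclideanSpace ℝ (Fin n)) :
    𝓕 ((c • f : 𝓢(EuclideanSpace ℝ (Fin n), ℂ)) : EuclideanSpace ℝ (Fin n) → ℂ) x =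
      c * 𝓕 (f : EuclideanSpace ℝ (Fin n) → ℂ) x := by
  simp only [← SchwartzMap.fourier_coe, FourierTransform.fourier_smul]
  rfl

theorem integrable_brIntegrand (hδ : 0 < δ) (f g : 𝓢(EuclideanSpace ℝ (Fin n), ℂ))
    (x : EuclideanSpace ℝ (Fin n)) :
    Integrable fun z : EuclideanSpace ℝ (Fin n) × EuclideanSpace ℝ (Fin n) =>
      Real.fourierChar ⟪x, z.1 + z.2⟫ • (brSymbol δ z *
        𝓕 (f : EuclideanSpace ℝ (Fin n) → ℂ) z.1 * 𝓕 (g : EuclideanSpace ℝ (Fin n) → ℂ) z.2) :=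
  integrable_fourierChar_smul (by fun_prop)
    (integrable_brSymbol_mul hδ (integrable_fourier f) (integrable_fourier g))

theorem bilinearBochnerRiesz_add_left (hδ : 0 < δ) (f f' g : 𝓢(EuclideanSpace ℝ (Fin n), ℂ)) :
    bilinearBochnerRiesz n δ (f + f') g =
      bilinearBochnerRiesz n δ f g + bilinearBochnerRiesz n δ f' g := by
  ext x
  simp only [bilinearBochnerRiesz_eq, Pi.add_apply, bilinearMultiplier]
  rw [← integral_add (integrable_brIntegrand hδ f g x) (integrable_brIntegrand hδ f' g x)]
  refine integral_congr_ae (.of_forall fun z => ?_)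
  simp only [fourier_add_apply, Circle.smul_def, smul_eq_mul]
  ring

theorem bilinearBochnerRiesz_add_right (hδ : 0 < δ) (f g g' : 𝓢(EuclideanSpace ℝ (Fin n), ℂ)) :
    bilinearBochnerRiesz n δ f (g + g') =
      bilinearBochnerRiesz n δ f g + bilinearBochnerRiesz n δ f g' := by
  ext x
  simp only [bilinearBochnerRiesz_eq, Pi.add_apply, bilinearMultiplier]
  rw [← integral_add (integrable_brIntegrand hδ f g x) (integrable_brIntegrand hδ f g' x)]
  refine integral_congr_ae (.of_forall fun z => ?_)
  simp only [fourier_add_apply, Circle.smul_def, smul_eq_mul]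
  ring

theorem bilinearBochnerRiesz_smul_left (c : ℂ) (f g : 𝓢(EuclideanSpace ℝ (Fin n), ℂ)) :
    bilinearBochnerRiesz n δ (c • f) g = c • bilinearBochnerRiesz n δ f g := by
  ext x
  simp only [bilinearBochnerRiesz_eq, Pi.smul_apply, bilinearMultiplier]
  rw [← integral_smul]
  refine integral_congr_ae (.of_forall fun z => ?_)
  simp only [fourier_smul_apply, Circle.smul_def, smul_eq_mul]
  ring

theorem bilinearBochnerRiesz_smul_right (c : ℂ) (f g : 𝓢(EuclideanSpace ℝ (Fin n), ℂ)) :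
    bilinearBochnerRiesz n δ f (c • g) = c • bilinearBochnerRiesz n δ f g := by
  ext x
  simp only [bilinearBochnerRiesz_eq, Pi.smul_apply, bilinearMultiplier]
  rw [← integral_smul]
  refine integral_congr_ae (.of_forall fun z => ?_)
  simp only [fourier_smul_apply, Circle.smul_def, smul_eq_mul]
  ring

end Bilinear

theorem isBoundedBilinearOp_bilinearBochnerRiesz {n : ℕ} (hn : 2 ≤ n) {p q r δ : ℝ} (hp : 1 < p)
    (hq : 1 < q) (hr : 1 ≤ r) (hpqr : 1 / r = 1 / p + 1 / q) (hδ : 0 < δ)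
    (hδ' : n * max 0 (1 / 2 - 1 / p) + n * max 0 (1 / 2 - 1 / q) - shellGain r < δ) :
    IsBoundedBilinearOp n p q r (bilinearBochnerRiesz n δ) := by
  have hfr : Module.finrank ℝ (EuclideanSpace ℝ (Fin n)) = n := finrank_euclideanSpace_fin
  obtain ⟨C, hC, hCb⟩ := exists_eLpNorm'_brOperator_le (V := EuclideanSpace ℝ (Fin n))
    (by rwa [hfr]) hp hq hr hpqr hδ (by simpa only [ballLoss, hfr] using hδ')
  have hL : ∀ {s : ℝ}, 1 ≤ s → ∀ F : EuclideanSpace ℝ (Fin n) → ℂ,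
      eLpNorm F (ENNReal.ofReal s) volume = eLpNorm' F s volume := fun {s} hs F => by
    rw [eLpNorm_eq_eLpNorm' (by simpa using by linarith) ENNReal.ofReal_ne_top,
      ENNReal.toReal_ofReal (by linarith)]
  refine isBoundedBilinearOp_of_eLpNorm_le hp.le hq.le hr (bilinearBochnerRiesz_add_left hδ)
    (bilinearBochnerRiesz_add_right hδ) bilinearBochnerRiesz_smul_left
    bilinearBochnerRiesz_smul_right (fun f g => ?_) hC fun f g => ?_
  · rw [bilinearBochnerRiesz_eq]
    exact (continuous_bilinearMultiplier_brSymbol hδ (integrable_fourier f)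
      (integrable_fourier g)).aestronglyMeasurable
  · rw [hL hr, hL hp.le, hL hq.le, bilinearBochnerRiesz_eq]
    exact hCb f g

/-- Here `r ≤ 2`, so the gain is `1/r'`, and the exponent below 2 loses nothing. Positivity of `δ`:
`1/p > 1/2` forces `1/2 - 1/q > 1/r'`, and `n ≥ 2`. -/
theorem bilinearBochnerRiesz_bounded_of_lt_two {n : ℕ} (hn : 2 ≤ n) {p q r r' δ : ℝ}
    (hr : r.HolderConjugate r') (hsum : 1 / p + 1 / q + 1 / r' = 1) (hp : 1 ≤ p) (hp2 : p < 2)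
    (hq : 2 ≤ q) (hr' : 2 ≤ r') (hδ : (n : ℝ) * (1 / 2 - 1 / q) - 1 / r' < δ) :
    1 < p ∧ 1 / r = 1 / p + 1 / q ∧ 0 < δ ∧
      n * max 0 (1 / 2 - 1 / p) + n * max 0 (1 / 2 - 1 / q) - shellGain r < δ := by
  have hrr : 1 / r + 1 / r' = 1 := by simpa [one_div] using hr.inv_add_inv_eq_one
  have hn' : (2 : ℝ) ≤ n := by exact_mod_cast hn
  have h1 : 0 < 1 / r' := by positivity
  have h2 : 0 < 1 / q := by positivity
  have h3 : 1 / r' ≤ 1 / 2 := one_div_le_one_div_of_le two_pos hr'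
  have h4 : 1 / q ≤ 1 / 2 := one_div_le_one_div_of_le two_pos hq
  have h5 : 1 / 2 < 1 / p := one_div_lt_one_div_of_lt (by linarith) hp2
  -- For `p = 1` the exponent relation would force `1/q + 1/r' = 0`.
  have hp1 : 1 < p := by
    refine lt_of_le_of_ne hp fun h => ?_
    rw [← h] at hsum
    linarith
  have hgain : shellGain r = 1 / r' := by
    rw [shellGain, min_eq_right] <;> linarith
  refine ⟨hp1, by linarith, ?_, ?_⟩
  · nlinarith
  · rw [hgain, max_eq_left (by linarith), max_eq_right (by linarith)]
    linarith

end Main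

theorem mainTheorem12 (n : ℕ) (hn : 2 ≤ n) (p q r r' δ : ℝ)
    (hr : r.HolderConjugate r') (hsum : 1 / p + 1 / q + 1 / r' = 1) :
    (2 ≤ p → 2 ≤ q → r' < 2 →
      ((n : ℝ) - 1) / 2 + n * (1 / r' - 1 / 2) < δ →
      IsBoundedBilinearOp n p q r (bilinearBochnerRiesz n δ)) ∧
    (1 ≤ p → p < 2 → 2 ≤ q → 2 ≤ r' →
      (n : ℝ) * (1 / 2 - 1 / q) - 1 / r' < δ →
      IsBoundedBilinearOp n p q r (bilinearBochnerRiesz n δ)) ∧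
    (1 ≤ q → q < 2 → 2 ≤ p → 2 ≤ r' →
      (n : ℝ) * (1 / 2 - 1 / p) - 1 / r' < δ →
      IsBoundedBilinearOp n p q r (bilinearBochnerRiesz n δ)) := by
  refine ⟨fun hp hq hr' hδ => ?_, fun hp hp2 hq hr' hδ => ?_, fun hq hq2 hp hr' hδ => ?_⟩
  · have hrr : 1 / r + 1 / r' = 1 := by simpa [one_div] using hr.inv_add_inv_eq_one
    have hn' : (2 : ℝ) ≤ n := by exact_mod_cast hn
    have h1 : 1 / 2 < 1 / r' := one_div_lt_one_div_of_lt hr.symm.pos hr'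
    have h2 : 1 / p ≤ 1 / 2 := one_div_le_one_div_of_le two_pos hp
    have h3 : 1 / q ≤ 1 / 2 := one_div_le_one_div_of_le two_pos hq
    refine isBoundedBilinearOp_bilinearBochnerRiesz hn (by linarith) (by linarith) hr.lt.le
      (by linarith) ?_ ?_
    · nlinarith
    -- Now `r > 2`, so the gain is `1/2`, while the losses add up to `n(1 - 1/p - 1/q) = n/r'`; the
    -- difference is the threshold.
    · rw [shellGain, min_eq_left (by linarith), max_eq_right (by linarith),
        max_eq_right (by linarith)]
      have e : 1 / r' = 1 - 1 / p - 1 / q := by linarith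
      rw [e] at hδ
      linarith
  · obtain ⟨h1, h2, h3, h4⟩ := bilinearBochnerRiesz_bounded_of_lt_two hn hr hsum hp hp2 hq hr' hδ
    exact isBoundedBilinearOp_bilinearBochnerRiesz hn h1 (by linarith) hr.lt.le h2 h3 h4
  -- The exponent conditions are symmetric in `p` and `q`.
  · obtain ⟨h1, h2, h3, h4⟩ := bilinearBochnerRiesz_bounded_of_lt_two hn hr
      (by linarith : 1 / q + 1 / p + 1 / r' = 1) hq hq2 hp hr' hδ
    exact isBoundedBilinearOp_bilinearBochnerRiesz hn (by linarith) h1 hr.lt.le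
      (by linarith) h3 (by linarith)
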